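/- Let $\mathcal X$ be an infinite-dimensional separable real Hilbert space, with inner product $\langle\cdot,\cdot\rangle$ and norm $\|\cdot\|$. Let $\mathcal A$ be a self-adjoint positive-definite (possibly unbounded) operator in $\mathcal X$ with bounded inverse $\mathcal A^{-1}$, let $\mathcal C_1$ be a bounded self-adjoint positive-definite operator (not necessarily trace class), and let $\mathcal C_0$ be a self-adjoint positive-definite trace class operator with orthonormal eigenbasis $(\varphi_k)$ and eigenvalues $\kappa_k>0$. Let $n,\tau>0$ and $\lambda=\frac1{n\tau^2}$. For $t\in\mathbb R$ let $X^t$ be the completion of $\mathcal M=\bigcap_{l\ge 0}\mathcal D(\mathcal C_0^{-l})$ under $\|u\|_t=\|\mathcal C_0^{-t/2}u\|$, i.e. the space of formal series $a=\sum_k a_k\varphi_k$ with $\|a\|_t^2=\sum_k\kappa_k^{-t}a_k^2<\infty$. Assume that there are $s_0\in[0,1)$, $\beta,\ell\ge0$ and $c_1,\dots,c_4>0$ such that 1. $\mathcal C_0^s$ is trace class for all $s>s_0$; 2. $2\ell-\beta+1>2s_0$; 3. $\|\mathcal C_1^{-1/2}\mathcal A^{-1}u\|\asymp\|\mathcal C_0^{\ell-\beta/2}u\|$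 for all $u\in X^{\beta-2\ell}$ (two-sided bound with positive constants); 4. $\|\mathcal C_0^{-\rho/2}\mathcal C_1^{1/2}u\|\le c_1\|\mathcal C_0^{(\beta-\rho)/2}u\|$ for all $u\in X^{\rho-\beta}$, $\rho\in[\lceil\beta-s_0-1\rceil,\beta-s_0)$; 5. $\|\mathcal C_0^{s/2}\mathcal C_1^{-1/2}u\|\le c_2\|\mathcal C_0^{(s-\beta)/2}u\|$ for all $u\in X^{\beta-s}$, $s\in(s_0,1]$; 6. $\|\mathcal C_0^{-s/2}\mathcal C_1^{-1/2}\mathcal A^{-1}u\|\le c_3\|\mathcal C_0^{(2\ell-\beta-s)/2}u\|$ for all $u\in X^{s+\beta-2\ell}$, $s\in(s_0,1]$; 7. $\|\mathcal C_0^{\eta/2}\mathcal A^{-1}\mathcal C_1^{-1}u\|\le c_4\|\mathcal C_0^{\eta/2+\ell-\beta}u\|$ for all $u\in X^{2\beta-2\ell-\eta}$, $\eta\in[\beta-2\ell,1]$. Here an estimate on $X^a$ means that the expression on the left is defined and the estimate holds on the dense subspace $\mathcal M$, the operator being then extended to $X^a$ by continuity; $\mathcal A^{-1}\mathcal C_1^{-1}u$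 is understood weakly, $\langle\mathcal A^{-1}\mathcal C_1^{-1}u,v\rangle=\langle\mathcal C_1^{-1/2}u,\mathcal C_1^{-1/2}\mathcal A^{-1}v\rangle$. Let $u\sim\mathcal N(0,\tau^2\mathcal C_0)$ be a random element of $\mathcal X$, let $\xi\sim\mathcal N(0,\mathcal C_1)$ be independent of $u$ (that is, the coefficients $\xi_k=\langle\xi,\varphi_k\rangle$ are centered and jointly Gaussian with covariances $\langle\mathcal C_1\varphi_i,\varphi_j\rangle$), let $y=\mathcal A^{-1}u+n^{-1/2}\xi$ (as a sequence of coefficients), and let the posterior $\mu^y$ be the conditional distribution of $u$ given $y$. Then $\mathcal C_1^{-1/2}\mathcal A^{-1}$ is defined on all of $X^1$, and there is a bounded self-adjoint positive-definite operator $\mathcal C$ on $\mathcal X$, not depending on $y$, with $$\mathcal C^{-1}=n\,\mathcal A^{-1}\mathcal C_1^{-1}\mathcal A^{-1}+\tau^{-2}\mathcal C_0^{-1},$$ where the right-hand side is the weakly defined operator on $X^1$ and $\mathcal D(\mathcal C^{-1})$ consists of those $w\in X^1$ that it maps into $\mathcal X$, such that for almost every $y$ the following hold: $y\in X^{2\beta-2\ell-1}$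 and $r=\mathcal A^{-1}\mathcal C_1^{-1}y$ is a well-defined element of $X^{-1}$; there is exactly one weak solution $m\in X^1$ of $\mathcal B_\lambda m=\mathcal A^{-1}\mathcal C_1^{-1}y$, that is, exactly one $m\in X^1$ with $$\langle\mathcal C_1^{-1/2}\mathcal A^{-1}m,\mathcal C_1^{-1/2}\mathcal A^{-1}v\rangle+\lambda\langle\mathcal C_0^{-1/2}m,\mathcal C_0^{-1/2}v\rangle=\langle r,v\rangle\qquad\text{for all }v\in X^1;$$ and $\mu^y=\mathcal N(m,\mathcal C)$. -/

import Mathlib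

open MeasureTheory ProbabilityTheory Filter Topology
open scoped RealInnerProductSpace

namespace BayesInverse

/-- A bounded operator is self-adjoint and positive-definite. -/
def PositiveDefinite {X : Type*} [NormedAddCommGroup X] [InnerProductSpace ℝ X]
    (T : X →L[ℝ] X) : Prop :=
  (∀ x y : X, ⟪T x, y⟫ = ⟪x, T y⟫) ∧ ∀ x : X, x ≠ 0 → 0 < ⟪T x, x⟫

/-- The operators of the inverse problem `y = A⁻¹ u + n^(-1/2) ξ` on a Hilbert space `X`, together
with an orthonormal eigenbasis of the prior covariance operator. -/
structure Setting (X : Type*) [NormedAddCommGroup X] [InnerProductSpace ℝ X]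
    [CompleteSpace X] where
  /-- the prior covariance operator (up to the factor `τ²`) -/
  C₀ : X →L[ℝ] X
  C₀_posDef : PositiveDefinite C₀
  /-- an orthonormal eigenbasis of `C₀` -/
  φ : HilbertBasis ℕ ℝ X
  /-- the eigenvalues of `C₀` -/
  κ : ℕ → ℝ
  C₀_eigen : ∀ k, C₀ (φ k) = κ k • φ k
  /-- the noise covariance operator -/
  C₁ : X →L[ℝ] X
  C₁_posDef : PositiveDefinite C₁
  /-- the (unique) positive square root of `C₁` -/
  sqrtC₁ : X →L[ℝ] X
  sqrtC₁_pos : sqrtC₁.IsPositive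
  sqrtC₁_sq : ∀ x, sqrtC₁ (sqrtC₁ x) = C₁ x
  /-- the, in general unbounded, self-adjoint and positive-definite operator `A` -/
  A : X →ₗ.[ℝ] X
  A_selfAdjoint : IsSelfAdjoint A
  A_pos : ∀ x : A.domain, x ≠ 0 → 0 < ⟪A x, (x : X)⟫
  /-- the bounded inverse of `A` -/
  Ainv : X →L[ℝ] X
  Ainv_spec : ∀ x z : X, Ainv x = z ↔ ∃ h : z ∈ A.domain, A ⟨z, h⟩ = x

namespace Setting

noncomputable section

variable {X : Type*} [NormedAddCommGroup X] [InnerProductSpace ℝ X] [CompleteSpace X]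
  (S : Setting X)

/-- The coefficients of `x` in the eigenbasis. Through them `X`, and all the spaces `X^t` of the
Hilbert scale, are realized as spaces of real sequences. -/
def coeff (x : X) : ℕ → ℝ := fun k => ⟪S.φ k, x⟫

/-- The Hilbert scale: a sequence `a` belongs to `X^t`, the completion of `smooth` under
`‖C₀^(-t/2) ·‖`, iff `∑ κₖ^(-t) aₖ² < ∞`. -/
def MemScale (t : ℝ) (a : ℕ → ℝ) : Prop :=
  Summable fun k => S.κ k ^ (-t) * a k ^ 2

/-- The norm `‖a‖_t = ‖C₀^(-t/2) a‖` of `X^t` (meaningful for `a` in `X^t`). -/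
def scaleNorm (t : ℝ) (a : ℕ → ℝ) : ℝ :=
  √(∑' k, S.κ k ^ (-t) * a k ^ 2)

/-- The common core `⋂ₗ D(C₀^(-l))` of the Hilbert scale; `D(C₀^(-l)) = X^(2l)`. -/
def smooth : Set X :=
  {u | ∀ l : ℕ, S.MemScale (2 * (l : ℝ)) (S.coeff u)}

/-- The domain of `C₁^(-1/2)`. -/
def domInvSqrtC₁ : Set X := Set.range S.sqrtC₁

/-- The operator `C₁^(-1/2)` (meaningful on its domain `domInvSqrtC₁`). -/
def invSqrtC₁ : X → X := Function.invFun S.sqrtC₁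

/-- The operator `A⁻¹ C₁⁻¹`, defined weakly: for `u` in the domain of `C₁^(-1/2)`, the element
`A⁻¹ C₁⁻¹ u` of the Hilbert scale is given by
`⟪A⁻¹ C₁⁻¹ u, v⟫ = ⟪C₁^(-1/2) u, C₁^(-1/2) A⁻¹ v⟫`, that is, by the following coefficients. For `u`
in the domain of `C₁⁻¹` these are the coefficients of the vector `A⁻¹ (C₁⁻¹ u)` of `X`. -/
def AinvC₁inv (u : X) : ℕ → ℝ :=
  fun k => ⟪S.invSqrtC₁ u, S.invSqrtC₁ (S.Ainv (S.φ k))⟫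

/-- The assumptions on `C₀`, `C₁` and `A⁻¹`, expressing `C₁ ≃ C₀^β` and `A⁻¹ ≃ C₀^ℓ`.
An estimate `‖T u‖_b ≤ c ‖u‖_a` for all `u ∈ X^a` is an estimate on the dense subspace `smooth` of
`X^a`, from which `T` is extended to `X^a` by continuity. That the left-hand side makes sense on
`smooth` (domains, and membership in `X^b`) is part of the estimate. -/
structure Assumptions (s₀ β ℓ c₁ c₂ c₃ c₄ : ℝ) : Prop where
  s₀_nonneg : 0 ≤ s₀
  s₀_lt_one : s₀ < 1
  β_nonneg : 0 ≤ β
  ℓ_nonneg : 0 ≤ ℓ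
  c₁_pos : 0 < c₁
  c₂_pos : 0 < c₂
  c₃_pos : 0 < c₃
  c₄_pos : 0 < c₄
  /-- `C₀^s` is trace class for all `s > s₀` -/
  trace : ∀ s : ℝ, s₀ < s → Summable fun k => S.κ k ^ s
  /-- `Δ > 2 s₀` -/
  delta : 2 * s₀ < 2 * ℓ - β + 1
  /-- `‖C₁^(-1/2) A⁻¹ u‖ ≍ ‖C₀^(ℓ - β/2) u‖` -/
  equiv : (∀ u ∈ S.smooth, S.Ainv u ∈ S.domInvSqrtC₁) ∧
    ∃ c c' : ℝ, 0 < c ∧ 0 < c' ∧ ∀ u ∈ S.smooth,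
      c * ‖S.invSqrtC₁ (S.Ainv u)‖ ≤ S.scaleNorm (β - 2 * ℓ) (S.coeff u) ∧
      S.scaleNorm (β - 2 * ℓ) (S.coeff u) ≤ c' * ‖S.invSqrtC₁ (S.Ainv u)‖
  /-- `‖C₀^(-ρ/2) C₁^(1/2) u‖ ≤ c₁ ‖C₀^((β-ρ)/2) u‖` -/
  sqrtC₁_bound : ∀ ρ : ℝ, (⌈β - s₀ - 1⌉ : ℝ) ≤ ρ → ρ < β - s₀ → ∀ u ∈ S.smooth,
    S.MemScale ρ (S.coeff (S.sqrtC₁ u)) ∧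
    S.scaleNorm ρ (S.coeff (S.sqrtC₁ u)) ≤ c₁ * S.scaleNorm (ρ - β) (S.coeff u)
  /-- `‖C₀^(s/2) C₁^(-1/2) u‖ ≤ c₂ ‖C₀^((s-β)/2) u‖` -/
  invSqrtC₁_bound : (∀ u ∈ S.smooth, u ∈ S.domInvSqrtC₁) ∧
    ∀ s : ℝ, s₀ < s → s ≤ 1 → ∀ u ∈ S.smooth,
      S.scaleNorm (-s) (S.coeff (S.invSqrtC₁ u)) ≤ c₂ * S.scaleNorm (β - s) (S.coeff u)
  /-- `‖C₀^(-s/2) C₁^(-1/2) A⁻¹ u‖ ≤ c₃ ‖C₀^((2ℓ-β-s)/2) u‖` -/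
  invSqrtC₁_Ainv_bound : ∀ s : ℝ, s₀ < s → s ≤ 1 → ∀ u ∈ S.smooth,
    S.MemScale s (S.coeff (S.invSqrtC₁ (S.Ainv u))) ∧
    S.scaleNorm s (S.coeff (S.invSqrtC₁ (S.Ainv u))) ≤
      c₃ * S.scaleNorm (s + β - 2 * ℓ) (S.coeff u)
  /-- `‖C₀^(η/2) A⁻¹ C₁⁻¹ u‖ ≤ c₄ ‖C₀^(η/2+ℓ-β) u‖` -/
  AinvC₁inv_bound : ∀ η : ℝ, β - 2 * ℓ ≤ η → η ≤ 1 → ∀ u ∈ S.smooth,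
    S.MemScale (-η) (S.AinvC₁inv u) ∧
    S.scaleNorm (-η) (S.AinvC₁inv u) ≤ c₄ * S.scaleNorm (2 * β - 2 * ℓ - η) (S.coeff u)

/-- `r = A⁻¹ C₁⁻¹ y` for the extension by continuity of `A⁻¹ C₁⁻¹` from `smooth` to an operator
from `X^a` to `X^(-1)`. -/
def IsAinvC₁inv (a : ℝ) (y r : ℕ → ℝ) : Prop :=
  S.MemScale a y ∧ S.MemScale (-1) r ∧
    ∃ u : ℕ → X, (∀ j, u j ∈ S.smooth) ∧
      Tendsto (fun j => S.scaleNorm a (S.coeff (u j) - y)) atTop (𝓝 0) ∧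
      Tendsto (fun j => S.scaleNorm (-1) (S.AinvC₁inv (u j) - r)) atTop (𝓝 0)

/-- The bilinear form
`B(w, v) = ⟪C₁^(-1/2) A⁻¹ w, C₁^(-1/2) A⁻¹ v⟫ + lam ⟪C₀^(-1/2) w, C₀^(-1/2) v⟫` on `X^1`. -/
def B (lam : ℝ) (w v : X) : ℝ :=
  ⟪S.invSqrtC₁ (S.Ainv w), S.invSqrtC₁ (S.Ainv v)⟫ +
    lam * ∑' k, (S.κ k)⁻¹ * (S.coeff w k * S.coeff v k)

/-- `w ∈ X^1` is a weak solution of `B_lam w = r`, where `r ∈ X^(-1)`. -/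
def IsWeakSolution (lam : ℝ) (r : ℕ → ℝ) (w : X) : Prop :=
  S.MemScale 1 (S.coeff w) ∧
    ∀ v : X, S.MemScale 1 (S.coeff v) → S.B lam w v = ∑' k, r k * S.coeff v k

/-- The element `(n A⁻¹ C₁⁻¹ A⁻¹ + τ⁻² C₀⁻¹) w` of `X^(-1)`, for `w ∈ X^1`. -/
def precision (n τ : ℝ) (w : X) : ℕ → ℝ :=
  fun k => n * S.AinvC₁inv (S.Ainv w) k + (τ ^ 2)⁻¹ * ((S.κ k)⁻¹ * S.coeff w k)

/-- `C⁻¹ = n A⁻¹ C₁⁻¹ A⁻¹ + τ⁻² C₀⁻¹`, as operators in `X`: the domain of `C⁻¹` consists of the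
`w ∈ X^1` which the right-hand side maps into `X`, and there both sides agree. -/
def HasPrecision (n τ : ℝ) (C : X →L[ℝ] X) : Prop :=
  ∀ x w : X, C x = w ↔ S.MemScale 1 (S.coeff w) ∧ S.precision n τ w = S.coeff x

/-- `μ` is the law, on coefficient sequences, of `N(0, C₁)`, where `C₁` need not be trace class:
`ξₖ = ⟪φₖ, ξ⟫` are centered, jointly Gaussian, with covariances `⟪C₁ φᵢ, φⱼ⟫`. -/
def IsNoiseLaw (μ : Measure (ℕ → ℝ)) : Prop :=
  IsGaussian μ ∧ (∀ k, ∫ a, a k ∂μ = 0) ∧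
    ∀ i j, cov[fun a => a i, fun a => a j; μ] = ⟪S.C₁ (S.φ i), S.φ j⟫

/-- The observation `y = A⁻¹ u + n^(-1/2) ξ`, as a coefficient sequence. -/
def data {Ω : Type*} (n : ℝ) (u : Ω → X) (ξ : Ω → ℕ → ℝ) (ω : Ω) : ℕ → ℝ :=
  fun k => S.coeff (S.Ainv (u ω)) k + (√n)⁻¹ * ξ ω k

end

end Setting

/-- `μ` is the Gaussian measure `N(m, C)` on the Hilbert space `X`. -/
def IsGaussianWith {X : Type*} [NormedAddCommGroup X] [InnerProductSpace ℝ X]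
    [MeasurableSpace X] [BorelSpace X] (μ : Measure X) (m : X) (C : X →L[ℝ] X) : Prop :=
  IsGaussian μ ∧ ∫ x, x ∂μ = m ∧ ∀ v w : X, covarianceBilin μ v w = ⟪C v, w⟫

end BayesInverse

/-! Substituting `w = C₀^(1/2) h` identifies `X^1` with `X` and turns the problem into one about the
bounded operator `L = C₁^(-1/2) A⁻¹ C₀^(1/2)`. The form `B` becomes the coercive form of `L*L + λ`,
whose inverse `R` exists. The posterior covariance is `C = n⁻¹ C₀^(1/2) R C₀^(1/2)`, and the weak
solution is `m(y) = C₀^(1/2) R q` with `q = C₀^(1/2) A⁻¹ C₁⁻¹ y = ∑ yᵢ L* C₁^(-1/2) φᵢ`. This series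
converges because almost every `y` lies in `X^(2β-2ℓ-1)` (`ae_memScale`) and the bound on `A⁻¹ C₁⁻¹`
with `η = 1` controls it (`summable_data`).

No density or Bayes formula is needed. It suffices that the error `u - m(y)` has law `N(0, C)` and
is independent of `y`: the conditional law is then that law translated by `m(y)`
(`condDistrib_ae_eq_map_add`). Both facts follow from the factorization of the joint characteristic
function of error and data (`charFun_error_data`), where the cross terms cancel because `τ² λ =
n⁻¹`.

The delicate point is that pairing `m(y)` with a vector is an infinite linear combination of data
coefficients, while Gaussianity of the data concerns finite ones. Passing to the limit needs `L h =
∑ ⟪L* C₁^(-1/2) φᵢ, h⟫ C₁^(1/2) φᵢ` (`hasSum_forward`). Formally this expands `C₁^(-1/2) L h` in the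
eigenbasis, but that vector need not lie in `X`, so the scale estimates are required. -/

/-- A series in a complete space converges if its finite sums are square-dominated by those of a
convergent series of real numbers. -/
lemma summable_of_norm_sum_sq_le {E : Type*} [NormedAddCommGroup E] [CompleteSpace E]
    {f : ℕ → E} {g : ℕ → ℝ} (hg : Summable g) {c : ℝ}
    (h : ∀ F : Finset ℕ, ‖∑ i ∈ F, f i‖ ^ 2 ≤ c * ∑ i ∈ F, g i) : Summable f := by
  rw [summable_iff_vanishing_norm] at hg ⊢
  intro ε hε
  -- The sign of `c` is unrestricted; `|c| + 1` is positive even for `c = 0`.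
  obtain ⟨s, hs⟩ := hg (ε ^ 2 / (|c| + 1)) (by positivity)
  refine ⟨s, fun t ht => ?_⟩
  have h1 := hs t ht
  have h2 : ‖∑ i ∈ t, f i‖ ^ 2 < ε ^ 2 := by
    calc ‖∑ i ∈ t, f i‖ ^ 2 ≤ c * ∑ i ∈ t, g i := h t
      _ ≤ |c| * ‖∑ i ∈ t, g i‖ := by
        rw [Real.norm_eq_abs, ← abs_mul]; exact le_abs_self _
      _ ≤ (|c| + 1) * ‖∑ i ∈ t, g i‖ := by gcongr; linarith
      _ < (|c| + 1) * (ε ^ 2 / (|c| + 1)) := by gcongr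
      _ = ε ^ 2 := by field_simp
  exact lt_of_pow_lt_pow_left₀ 2 hε.le h2

/-! ### Coefficients and weak convergence in a Hilbert basis. -/

namespace HilbertBasis

variable {X : Type*} [NormedAddCommGroup X] [InnerProductSpace ℝ X] (b : HilbertBasis ℕ ℝ X)

lemma ext_inner {x y : X} (h : ∀ k, ⟪b k, x⟫ = ⟪b k, y⟫) : x = y := by
  apply b.repr.injective
  ext k
  simpa [b.repr_apply_apply] using h k

lemma hasSum_inner_sq (x : X) : HasSum (fun k => ⟪b k, x⟫ ^ 2) (‖x‖ ^ 2) := by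
  have h := b.hasSum_inner_mul_inner x x
  rw [real_inner_self_eq_norm_sq] at h
  simpa only [sq, real_inner_comm x] using h

lemma inner_self (i j : ℕ) : ⟪b i, b j⟫ = if i = j then (1 : ℝ) else 0 :=
  orthonormal_iff_ite.1 b.orthonormal i j

lemma exists_inner_eq {a : ℕ → ℝ} (ha : Summable fun k => a k ^ 2) :
    ∃ x : X, ∀ k, ⟪b k, x⟫ = a k := by
  have : Memℓp a 2 := by
    refine memℓp_gen ?_
    simpa using ha
  refine ⟨b.repr.symm ⟨a, this⟩, fun k => ?_⟩
  rw [← b.repr_apply_apply]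
  simp

lemma hasSum_smul (x : X) : HasSum (fun k => ⟪b k, x⟫ • b k) x := by
  simpa [b.repr_apply_apply] using b.hasSum_repr x

lemma inner_sum_smul (F : Finset ℕ) (a : ℕ → ℝ) (k : ℕ) :
    ⟪b k, ∑ i ∈ F, a i • b i⟫ = if k ∈ F then a k else 0 := by
  simp [inner_sum, inner_smul_right, b.inner_self]

/-- A bounded sequence whose coefficients converge is weakly convergent. -/
lemma tendsto_inner_of_bounded {q : ℕ → X} {p : X} {c : ℝ} (hc : ∀ j, ‖q j‖ ≤ c)
    (h : ∀ k, Tendsto (fun j => ⟪b k, q j⟫) atTop (𝓝 ⟪b k, p⟫)) (x : X) :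
    Tendsto (fun j => ⟪q j, x⟫) atTop (𝓝 ⟪p, x⟫) := by
  rw [Metric.tendsto_atTop]
  intro ε hε
  have hc0 : 0 ≤ c := (norm_nonneg _).trans (hc 0)
  have hδ : 0 < ε / (2 * (c + ‖p‖ + 1)) := by positivity
  obtain ⟨F, hF⟩ := (Metric.tendsto_nhds.1 (b.hasSum_smul x) _ hδ).exists
  set z := ∑ k ∈ F, ⟪b k, x⟫ • b k with hz
  have h1 : Tendsto (fun j => ⟪q j, z⟫) atTop (𝓝 ⟪p, z⟫) := by
    simp only [hz, inner_sum, inner_smul_right]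
    refine tendsto_finsetSum _ fun k _ => (Tendsto.const_mul _ ?_)
    simpa only [real_inner_comm] using h k
  obtain ⟨N, hN⟩ := Metric.tendsto_atTop.1 h1 (ε / 2) (by positivity)
  refine ⟨N, fun j hj => ?_⟩
  have h2 := hN j hj
  rw [Real.dist_eq] at h2 ⊢
  rw [dist_eq_norm] at hF
  have h3 : ⟪q j, x⟫ - ⟪p, x⟫ = (⟪q j, z⟫ - ⟪p, z⟫) - ⟪q j - p, z - x⟫ := by
    simp only [inner_sub_left, inner_sub_right]; ring
  have h4 : |⟪q j - p, z - x⟫| ≤ (c + ‖p‖) * ‖z - x‖ :=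
    (abs_real_inner_le_norm _ _).trans
      (by gcongr; exact (norm_sub_le _ _).trans (by gcongr; exact hc j))
  have h5 : (c + ‖p‖) * ‖z - x‖ ≤ (c + ‖p‖ + 1) * (ε / (2 * (c + ‖p‖ + 1))) :=
    mul_le_mul (by linarith) hF.le (norm_nonneg _) (by positivity)
  have h6 : (c + ‖p‖ + 1) * (ε / (2 * (c + ‖p‖ + 1))) = ε / 2 := by field_simp
  rw [h3]
  calc _ ≤ |⟪q j, z⟫ - ⟪p, z⟫| + |⟪q j - p, z - x⟫| := abs_sub _ _
    _ < ε := by linarith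

end HilbertBasis

/-! ### The Hilbert scale and the square root of `C₀`. -/

namespace BayesInverse.Setting

variable {X : Type*} [NormedAddCommGroup X] [InnerProductSpace ℝ X] [CompleteSpace X]
  (S : Setting X)

lemma κ_pos (k : ℕ) : 0 < S.κ k := by
  have h := S.C₀_posDef.2 (S.φ k) (S.φ.orthonormal.ne_zero k)
  rw [S.C₀_eigen, real_inner_smul_left, S.φ.inner_self] at h
  simpa using h

lemma κ_le (k : ℕ) : S.κ k ≤ ‖S.C₀‖ := by
  have h := S.C₀.le_opNorm (S.φ k)
  rwa [S.C₀_eigen, norm_smul, S.φ.orthonormal.1 k, mul_one, mul_one,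
    Real.norm_of_nonneg (S.κ_pos k).le] at h

lemma rpow_half_sq (t : ℝ) (k : ℕ) : (S.κ k ^ (t / 2)) ^ 2 = S.κ k ^ t := by
  rw [← Real.rpow_natCast, ← Real.rpow_mul (S.κ_pos k).le]
  norm_num

lemma rpow_half_mul_sq (t x : ℝ) (k : ℕ) :
    (S.κ k ^ (-t / 2) * x) ^ 2 = S.κ k ^ (-t) * x ^ 2 := by
  rw [mul_pow, rpow_half_sq]

/-- The eigenvalues are bounded by `‖C₀‖`, so lowering the exponent of the scale costs at most the
factor `‖C₀‖ ^ (t' - t)`. -/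
lemma summable_rpow_mul_of_le {t t' : ℝ} (h : t ≤ t') {b : ℕ → ℝ} (hb : ∀ k, 0 ≤ b k)
    (hs : Summable fun k => S.κ k ^ (-t') * b k) : Summable fun k => S.κ k ^ (-t) * b k := by
  refine Summable.of_nonneg_of_le
    (fun k => mul_nonneg (Real.rpow_nonneg (S.κ_pos k).le _) (hb k)) (fun k => ?_)
    (hs.mul_left (‖S.C₀‖ ^ (t' - t)))
  rw [← mul_assoc]
  refine mul_le_mul_of_nonneg_right ?_ (hb k)
  calc S.κ k ^ (-t) = S.κ k ^ (t' - t) * S.κ k ^ (-t') := by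
        rw [← Real.rpow_add (S.κ_pos k)]; ring_nf
    _ ≤ _ := mul_le_mul_of_nonneg_right
      (Real.rpow_le_rpow (S.κ_pos k).le (S.κ_le k) (by linarith))
      (Real.rpow_nonneg (S.κ_pos k).le _)

variable {S}

lemma MemScale.of_le {t t' : ℝ} (h : t ≤ t') {a : ℕ → ℝ} (ha : S.MemScale t' a) :
    S.MemScale t a :=
  S.summable_rpow_mul_of_le h (fun k => sq_nonneg (a k)) ha

lemma MemScale.exists_inner_eq {t : ℝ} {a : ℕ → ℝ} (ha : S.MemScale t a) :
    ∃ x : X, ∀ k, ⟪S.φ k, x⟫ = S.κ k ^ (-t / 2) * a k :=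
  S.φ.exists_inner_eq (by simp only [rpow_half_mul_sq]; exact ha)

lemma hasSum_of_inner_eq {t : ℝ} {a : ℕ → ℝ} {x : X}
    (h : ∀ k, ⟪S.φ k, x⟫ = S.κ k ^ (-t / 2) * a k) :
    HasSum (fun k => S.κ k ^ (-t) * a k ^ 2) (‖x‖ ^ 2) := by
  simpa only [h, rpow_half_mul_sq] using S.φ.hasSum_inner_sq x

lemma memScale_of_inner_eq {t : ℝ} {a : ℕ → ℝ} {x : X}
    (h : ∀ k, ⟪S.φ k, x⟫ = S.κ k ^ (-t / 2) * a k) : S.MemScale t a :=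
  (hasSum_of_inner_eq h).summable

lemma scaleNorm_eq_norm {t : ℝ} {a : ℕ → ℝ} {x : X}
    (h : ∀ k, ⟪S.φ k, x⟫ = S.κ k ^ (-t / 2) * a k) : S.scaleNorm t a = ‖x‖ := by
  rw [scaleNorm, (hasSum_of_inner_eq h).tsum_eq, Real.sqrt_sq (norm_nonneg x)]

lemma scaleNorm_nonneg (t : ℝ) (a : ℕ → ℝ) : 0 ≤ S.scaleNorm t a := Real.sqrt_nonneg _

lemma scaleNorm_sq (t : ℝ) (a : ℕ → ℝ) :
    S.scaleNorm t a ^ 2 = ∑' k, S.κ k ^ (-t) * a k ^ 2 :=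
  Real.sq_sqrt (tsum_nonneg fun k => mul_nonneg (Real.rpow_nonneg (S.κ_pos k).le _) (sq_nonneg _))

lemma memScale_coeff_zero (x : X) : S.MemScale 0 (S.coeff x) :=
  memScale_of_inner_eq (x := x) (by simp [coeff])

lemma memScale_of_mem_smooth {x : X} (hx : x ∈ S.smooth) (t : ℝ) : S.MemScale t (S.coeff x) := by
  obtain ⟨l, hl⟩ := exists_nat_ge (t / 2)
  exact (hx l).of_le (by linarith)

lemma memScale_sum_smul (F : Finset ℕ) (a : ℕ → ℝ) (t : ℝ) :
    S.MemScale t (S.coeff (∑ i ∈ F, a i • S.φ i)) := by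
  refine summable_of_ne_finset_zero (s := F) fun k hk => ?_
  simp [coeff, S.φ.inner_sum_smul, hk]

lemma sum_smul_mem_smooth (F : Finset ℕ) (a : ℕ → ℝ) : ∑ i ∈ F, a i • S.φ i ∈ S.smooth :=
  fun _ => memScale_sum_smul F a _

lemma basis_mem_smooth (k : ℕ) : S.φ k ∈ S.smooth := by
  simpa using sum_smul_mem_smooth (S := S) {k} (fun _ => 1)

lemma scaleNorm_sum_smul_sq (F : Finset ℕ) (a : ℕ → ℝ) (t : ℝ) :
    S.scaleNorm t (S.coeff (∑ i ∈ F, a i • S.φ i)) ^ 2 = ∑ i ∈ F, S.κ i ^ (-t) * a i ^ 2 := by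
  rw [scaleNorm_sq, tsum_eq_sum (s := F)]
  · refine Finset.sum_congr rfl fun k hk => ?_
    simp [coeff, S.φ.inner_sum_smul, hk]
  · intro k hk
    simp [coeff, S.φ.inner_sum_smul, hk]

lemma sub_mem_smooth {x y : X} (hx : x ∈ S.smooth) (hy : y ∈ S.smooth) : x - y ∈ S.smooth := by
  intro l
  obtain ⟨x', hx'⟩ := (hx l).exists_inner_eq
  obtain ⟨y', hy'⟩ := (hy l).exists_inner_eq
  refine memScale_of_inner_eq (x := x' - y') fun k => ?_
  simp only [inner_sub_right, hx', hy', coeff]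
  ring

variable (S)

lemma exists_sqrtC₀ :
    ∃ D : X →L[ℝ] X, ∀ x k, ⟪S.φ k, D x⟫ = √(S.κ k) * ⟪S.φ k, x⟫ := by
  have h : ∀ x : X, ∃ z : X, ∀ k, ⟪S.φ k, z⟫ = √(S.κ k) * ⟪S.φ k, x⟫ := by
    intro x
    refine S.φ.exists_inner_eq ?_
    refine Summable.of_nonneg_of_le (fun k => sq_nonneg _) (fun k => ?_)
      ((S.φ.hasSum_inner_sq x).summable.mul_left ‖S.C₀‖)
    rw [mul_pow, Real.sq_sqrt (S.κ_pos k).le]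
    exact mul_le_mul_of_nonneg_right (S.κ_le k) (sq_nonneg _)
  choose D hD using h
  let D' : X →ₗ[ℝ] X :=
    { toFun := D
      map_add' := fun x y => S.φ.ext_inner fun k => by
        simp only [hD, inner_add_right]; ring
      map_smul' := fun c x => S.φ.ext_inner fun k => by
        simp only [hD, inner_smul_right, RingHom.id_apply]; ring }
  refine ⟨D'.mkContinuous √‖S.C₀‖ fun x => ?_, fun x k => hD x k⟩
  refine le_of_sq_le_sq ?_ (by positivity)
  rw [mul_pow, Real.sq_sqrt (norm_nonneg _)]
  refine hasSum_le (fun k => ?_) (S.φ.hasSum_inner_sq (D x))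
    ((S.φ.hasSum_inner_sq x).mul_left ‖S.C₀‖)
  rw [hD, mul_pow, Real.sq_sqrt (S.κ_pos k).le]
  exact mul_le_mul_of_nonneg_right (S.κ_le k) (sq_nonneg _)

/-- The operator `C₀^(1/2)`. -/
noncomputable def sqrtC₀ : X →L[ℝ] X := S.exists_sqrtC₀.choose

variable {S}

lemma inner_sqrtC₀ (x : X) (k : ℕ) : ⟪S.φ k, S.sqrtC₀ x⟫ = √(S.κ k) * ⟪S.φ k, x⟫ :=
  S.exists_sqrtC₀.choose_spec x k

lemma sqrtC₀_basis (k : ℕ) : S.sqrtC₀ (S.φ k) = √(S.κ k) • S.φ k := by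
  refine S.φ.ext_inner fun j => ?_
  rw [inner_sqrtC₀, inner_smul_right, S.φ.inner_self]
  split_ifs with h <;> simp [h]

lemma inner_sqrtC₀_left (x y : X) : ⟪S.sqrtC₀ x, y⟫ = ⟪x, S.sqrtC₀ y⟫ := by
  rw [← S.φ.tsum_inner_mul_inner, ← S.φ.tsum_inner_mul_inner]
  refine tsum_congr fun k => ?_
  rw [inner_sqrtC₀, real_inner_comm (S.φ k) (S.sqrtC₀ x), inner_sqrtC₀, real_inner_comm x]
  ring

lemma inner_C₀ (x : X) : ⟪S.C₀ x, x⟫ = ‖S.sqrtC₀ x‖ ^ 2 := by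
  have : S.C₀ x = S.sqrtC₀ (S.sqrtC₀ x) := by
    refine S.φ.ext_inner fun k => ?_
    rw [← S.C₀_posDef.1, S.C₀_eigen, real_inner_smul_left, inner_sqrtC₀, inner_sqrtC₀, ← mul_assoc,
      Real.mul_self_sqrt (S.κ_pos k).le]
  rw [this, inner_sqrtC₀_left, real_inner_self_eq_norm_sq]

lemma sqrtC₀_injective : Function.Injective S.sqrtC₀ := by
  intro x y h
  refine S.φ.ext_inner fun k => ?_
  have := congrArg (fun z => ⟪S.φ k, z⟫) h
  simp only [inner_sqrtC₀] at this
  exact mul_left_cancel₀ (Real.sqrt_pos.2 (S.κ_pos k)).ne' this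

/-- This is the change of variables that moves every question about `X^1` to `X`. -/
lemma memScale_one_iff {w : X} : S.MemScale 1 (S.coeff w) ↔ ∃ h, S.sqrtC₀ h = w := by
  have hk : ∀ k, √(S.κ k) * S.κ k ^ (-1 / 2 : ℝ) = 1 := fun k => by
    rw [Real.sqrt_eq_rpow, ← Real.rpow_add (S.κ_pos k)]; norm_num
  constructor
  · intro hw
    obtain ⟨h, hh⟩ := hw.exists_inner_eq
    refine ⟨h, S.φ.ext_inner fun k => ?_⟩
    rw [inner_sqrtC₀, hh, ← mul_assoc, hk, one_mul, coeff]
  · rintro ⟨h, rfl⟩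
    refine memScale_of_inner_eq (x := h) fun k => ?_
    rw [coeff, inner_sqrtC₀, ← mul_assoc, mul_comm (_ ^ _), hk, one_mul]

end BayesInverse.Setting

/-! ### The operator `L = C₁^(-1/2) A⁻¹ C₀^(1/2)`, its resolvent, and the weak problem. -/

namespace BayesInverse.Setting

variable {X : Type*} [NormedAddCommGroup X] [InnerProductSpace ℝ X] [CompleteSpace X]
  {S : Setting X} {s₀ β ℓ c₁ c₂ c₃ c₄ : ℝ}

open ContinuousLinearMap (adjoint)

lemma inner_sqrtC₁_left (x y : X) : ⟪S.sqrtC₁ x, y⟫ = ⟪x, S.sqrtC₁ y⟫ :=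
  S.sqrtC₁_pos.1 x y

lemma inner_C₁ (x : X) : ⟪S.C₁ x, x⟫ = ‖S.sqrtC₁ x‖ ^ 2 := by
  rw [← S.sqrtC₁_sq, inner_sqrtC₁_left, real_inner_self_eq_norm_sq]

lemma sqrtC₁_injective : Function.Injective S.sqrtC₁ := by
  refine (injective_iff_map_eq_zero S.sqrtC₁).2 fun x hx => ?_
  by_contra h
  have := S.C₁_posDef.2 x h
  rw [inner_C₁, hx] at this
  simp at this

lemma sqrtC₁_invSqrtC₁ {x : X} (hx : x ∈ S.domInvSqrtC₁) : S.sqrtC₁ (S.invSqrtC₁ x) = x :=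
  Function.invFun_eq hx

lemma invSqrtC₁_eq {x z : X} (h : S.sqrtC₁ z = x) : S.invSqrtC₁ x = z := by
  rw [← h]
  exact Function.leftInverse_invFun sqrtC₁_injective z

/-- `invSqrtC₁` is only a set-theoretic inverse; injectivity of `sqrtC₁` makes it linear on the
range. -/
lemma invSqrtC₁_sum_smul {f : ℕ → X} (hf : ∀ i, f i ∈ S.domInvSqrtC₁) (F : Finset ℕ) (a : ℕ → ℝ) :
    S.invSqrtC₁ (∑ i ∈ F, a i • f i) = ∑ i ∈ F, a i • S.invSqrtC₁ (f i) := by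
  refine invSqrtC₁_eq ?_
  simp only [map_sum, map_smul]
  exact Finset.sum_congr rfl fun i _ => by rw [sqrtC₁_invSqrtC₁ (hf i)]

lemma inner_Ainv_left (x y : X) : ⟪S.Ainv x, y⟫ = ⟪x, S.Ainv y⟫ := by
  obtain ⟨h₁, h₂⟩ := (S.Ainv_spec x (S.Ainv x)).1 rfl
  obtain ⟨h₃, h₄⟩ := (S.Ainv_spec y (S.Ainv y)).1 rfl
  have h := LinearPMap.adjoint_isFormalAdjoint S.A_selfAdjoint.dense_domain
  rw [LinearPMap.isSelfAdjoint_def.1 S.A_selfAdjoint] at h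
  have := h ⟨S.Ainv x, h₁⟩ ⟨S.Ainv y, h₃⟩
  rw [h₂, h₄] at this
  exact this.symm

lemma Assumptions.Ainv_basis_mem (hS : S.Assumptions s₀ β ℓ c₁ c₂ c₃ c₄) (i : ℕ) :
    S.Ainv (S.φ i) ∈ S.domInvSqrtC₁ := hS.equiv.1 _ (basis_mem_smooth i)

lemma Assumptions.basis_mem (hS : S.Assumptions s₀ β ℓ c₁ c₂ c₃ c₄) (i : ℕ) :
    S.φ i ∈ S.domInvSqrtC₁ := hS.invSqrtC₁_bound.1 _ (basis_mem_smooth i)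

/-- The domain of `C₁^(-1/2) A⁻¹` contains `X^1`. -/
lemma Assumptions.Ainv_mem (hS : S.Assumptions s₀ β ℓ c₁ c₂ c₃ c₄) {w : X}
    (hw : S.MemScale 1 (S.coeff w)) : S.Ainv w ∈ S.domInvSqrtC₁ := by
  have hw' : S.MemScale (β - 2 * ℓ) (S.coeff w) :=
    hw.of_le (by linarith [hS.delta, hS.s₀_nonneg])
  obtain ⟨-, c, _, hc, -, h⟩ := hS.equiv
  have hsum : Summable fun i => S.coeff w i • S.invSqrtC₁ (S.Ainv (S.φ i)) := by
    refine summable_of_norm_sum_sq_le hw' (c := (c⁻¹) ^ 2) fun F => ?_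
    rw [← scaleNorm_sum_smul_sq, ← invSqrtC₁_sum_smul hS.Ainv_basis_mem, ← mul_pow]
    have h1 := (h _ (sum_smul_mem_smooth F (S.coeff w))).1
    rw [map_sum] at h1
    simp only [map_smul] at h1
    gcongr
    rwa [← div_eq_inv_mul, le_div_iff₀' hc]
  -- The preimage is the sum of the series; applying `sqrtC₁` termwise gives the expansion of `A⁻¹
  -- w`.
  refine ⟨_, (S.sqrtC₁.hasSum hsum.hasSum).unique ?_⟩
  convert S.Ainv.hasSum (S.φ.hasSum_smul w) using 2 with i
  simp only [map_smul, sqrtC₁_invSqrtC₁ (hS.Ainv_basis_mem i)]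
  rfl

/-- The operator `C₁^(-1/2) A⁻¹ C₀^(1/2)` is everywhere defined and bounded. -/
lemma Assumptions.exists_forward (hS : S.Assumptions s₀ β ℓ c₁ c₂ c₃ c₄) :
    ∃ L : X →L[ℝ] X, ∀ h, S.sqrtC₁ (L h) = S.Ainv (S.sqrtC₀ h) := by
  have h : ∀ h, ∃ z, S.sqrtC₁ z = S.Ainv (S.sqrtC₀ h) := fun h =>
    hS.Ainv_mem (memScale_one_iff.2 ⟨h, rfl⟩)
  choose L hL using h
  let L' : X →ₗ[ℝ] X :=
    { toFun := L
      map_add' := fun x y => sqrtC₁_injective (S := S) (by simp only [hL, map_add])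
      map_smul' := fun c x => sqrtC₁_injective (S := S) (by simp only [hL, map_smul, RingHom.id_apply]) }
  -- Closed graph theorem: the graph is closed since `sqrtC₁` is continuous and injective.
  refine ⟨⟨L', L'.continuous_of_seq_closed_graph fun u x y hu hy => sqrtC₁_injective (S := S) ?_⟩, hL⟩
  have h1 := (S.sqrtC₁.continuous.tendsto y).comp hy
  have h2 := ((S.Ainv.comp S.sqrtC₀).continuous.tendsto x).comp hu
  refine (tendsto_nhds_unique h1 (h2.congr fun j => ?_)).trans (hL x).symm
  exact (hL (u j)).symm

section Forward

variable {L : X →L[ℝ] X} (hL : ∀ h, S.sqrtC₁ (L h) = S.Ainv (S.sqrtC₀ h))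

include hL

lemma invSqrtC₁_Ainv_sqrtC₀ (h : X) : S.invSqrtC₁ (S.Ainv (S.sqrtC₀ h)) = L h :=
  invSqrtC₁_eq (hL h)

/-- Taking adjoints in `C₁^(1/2) L = A⁻¹ C₀^(1/2)`. It lets the signal and the noise variances both
be expressed through `C₁^(1/2) e`. -/
lemma adjoint_sqrtC₁ (e : X) : adjoint L (S.sqrtC₁ e) = S.sqrtC₀ (S.Ainv e) := by
  refine ext_inner_right ℝ fun x => ?_
  rw [ContinuousLinearMap.adjoint_inner_left, inner_sqrtC₁_left, hL, inner_sqrtC₀_left,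
    inner_Ainv_left]

lemma Assumptions.forward_basis (hS : S.Assumptions s₀ β ℓ c₁ c₂ c₃ c₄) (k : ℕ) :
    L (S.φ k) = √(S.κ k) • S.invSqrtC₁ (S.Ainv (S.φ k)) := by
  refine sqrtC₁_injective (S := S) ?_
  rw [hL, sqrtC₀_basis, map_smul, map_smul, sqrtC₁_invSqrtC₁ (hS.Ainv_basis_mem k)]

/-- So `L* C₁^(-1/2)` is `C₀^(1/2) A⁻¹ C₁⁻¹`, and norms in `X^(-1)` become norms in `X`. -/
lemma Assumptions.inner_adjoint_invSqrtC₁ (hS : S.Assumptions s₀ β ℓ c₁ c₂ c₃ c₄) (x : X) (k : ℕ) :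
    ⟪S.φ k, adjoint L (S.invSqrtC₁ x)⟫ = √(S.κ k) * S.AinvC₁inv x k := by
  rw [ContinuousLinearMap.adjoint_inner_right, hS.forward_basis hL, real_inner_smul_left,
    real_inner_comm]
  rfl

lemma B_sqrtC₀ (lam : ℝ) (h g : X) :
    S.B lam (S.sqrtC₀ h) (S.sqrtC₀ g) = ⟪adjoint L (L h) + lam • h, g⟫ := by
  rw [B, invSqrtC₁_Ainv_sqrtC₀ hL, invSqrtC₁_Ainv_sqrtC₀ hL, inner_add_left,
    ContinuousLinearMap.adjoint_inner_left, real_inner_smul_left, ← S.φ.tsum_inner_mul_inner h g]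
  congr 2
  refine tsum_congr fun k => ?_
  rw [coeff, coeff, inner_sqrtC₀, inner_sqrtC₀, real_inner_comm h]
  have h2 := S.κ_pos k
  field_simp
  rw [Real.sq_sqrt h2.le]

omit hL in
-- Coercivity: `⟪(L*L + lam) x, x⟫ ≥ lam ‖x‖²`, as in Lax–Milgram.
lemma exists_resolvent (L : X →L[ℝ] X) {lam : ℝ} (hlam : 0 < lam) :
    ∃ R : X →L[ℝ] X, (∀ x, adjoint L (L (R x)) + lam • R x = x) ∧
      ∀ x, R (adjoint L (L x) + lam • x) = x := by
  set T : X →L[ℝ] X := (adjoint L).comp L + lam • ContinuousLinearMap.id ℝ X with hT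
  have hT' : ∀ x, T x = adjoint L (L x) + lam • x := fun x => by simp [hT]
  have : IsUnit T := by
    refine ContinuousLinearMap.isUnit_of_forall_le_norm_inner_map T (c := ⟨lam, hlam.le⟩) hlam
      fun x => ?_
    rw [hT', inner_add_left, ContinuousLinearMap.adjoint_inner_left, real_inner_smul_left,
      real_inner_self_eq_norm_sq, real_inner_self_eq_norm_sq, Real.norm_of_nonneg (by positivity)]
    change ‖x‖ ^ 2 * lam ≤ _
    nlinarith [sq_nonneg ‖L x‖]
  obtain ⟨U, hU⟩ := this
  refine ⟨(U⁻¹ : (X →L[ℝ] X)ˣ), fun x => ?_, fun x => ?_⟩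
  · rw [← hT', ← hU, ← mul_apply_eq_comp]
    simp
  · rw [← hT', ← hU, ← mul_apply_eq_comp]
    simp

section Resolvent

variable {lam : ℝ} {R : X →L[ℝ] X} (hR : ∀ x, adjoint L (L (R x)) + lam • R x = x)
  (hR' : ∀ x, R (adjoint L (L x) + lam • x) = x)

include hR

omit hL in
lemma resolvent_inner_left (x y : X) : ⟪R x, y⟫ = ⟪x, R y⟫ := by
  nth_rw 1 [← hR y]
  nth_rw 2 [← hR x]
  simp only [inner_add_left, inner_add_right, ContinuousLinearMap.adjoint_inner_left,
    ContinuousLinearMap.adjoint_inner_right, real_inner_smul_left, real_inner_smul_right]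

omit hL in
lemma inner_resolvent_self (x : X) : ⟪R x, x⟫ = ‖L (R x)‖ ^ 2 + lam * ‖R x‖ ^ 2 := by
  nth_rw 2 [← hR x]
  simp only [inner_add_right, ContinuousLinearMap.adjoint_inner_right, real_inner_smul_right,
    real_inner_self_eq_norm_sq]

omit hL in
lemma posDef_posterior {n : ℝ} (hn : 0 < n) (hlam : 0 < lam) :
    PositiveDefinite (n⁻¹ • S.sqrtC₀.comp (R.comp S.sqrtC₀)) := by
  constructor
  · intro x y
    simp only [smul_apply, ContinuousLinearMap.comp_apply, real_inner_smul_left,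
      real_inner_smul_right, inner_sqrtC₀_left, resolvent_inner_left hR]
  · intro x hx
    simp only [smul_apply, ContinuousLinearMap.comp_apply, real_inner_smul_left,
      inner_sqrtC₀_left, inner_resolvent_self hR]
    have h1 : R (S.sqrtC₀ x) ≠ 0 := by
      intro h
      have h2 := hR (S.sqrtC₀ x)
      rw [h] at h2
      refine hx (sqrtC₀_injective (S := S) ?_)
      rw [map_zero, ← h2]
      simp
    have := norm_pos_iff.2 h1
    positivity

include hL hR'

/-- With `w = C₀^(1/2) h`, multiplying the precision equation by `C₀^(1/2)` gives `n (L*L + lam) h =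
C₀^(1/2) x`, because `n lam = τ⁻²`; the resolvent solves it. -/
lemma Assumptions.hasPrecision (hS : S.Assumptions s₀ β ℓ c₁ c₂ c₃ c₄) {n τ : ℝ} (hn : 0 < n)
    (hτ : 0 < τ) (hlam : lam = 1 / (n * τ ^ 2)) :
    S.HasPrecision n τ (n⁻¹ • S.sqrtC₀.comp (R.comp S.sqrtC₀)) := by
  have key : ∀ h k, S.precision n τ (S.sqrtC₀ h) k * √(S.κ k) =
      n * ⟪S.φ k, adjoint L (L h) + lam • h⟫ := by
    intro h k
    have h1 := hS.inner_adjoint_invSqrtC₁ hL (S.Ainv (S.sqrtC₀ h)) k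
    rw [invSqrtC₁_Ainv_sqrtC₀ hL] at h1
    rw [inner_add_right, h1, precision, coeff, inner_sqrtC₀, inner_smul_right, hlam]
    have h2 := S.κ_pos k
    have h3 := Real.sq_sqrt h2.le
    field_simp
    linear_combination ⟪S.φ k, h⟫ * h3
  intro x w
  constructor
  · rintro rfl
    refine ⟨memScale_one_iff.2 ⟨n⁻¹ • R (S.sqrtC₀ x), by simp⟩, funext fun k => ?_⟩
    have h1 := key (n⁻¹ • R (S.sqrtC₀ x)) k
    have h2 : adjoint L (L (n⁻¹ • R (S.sqrtC₀ x))) + lam • n⁻¹ • R (S.sqrtC₀ x) =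
        n⁻¹ • S.sqrtC₀ x := by
      nth_rw 3 [← hR (S.sqrtC₀ x)]
      rw [smul_add, map_smul, map_smul, smul_comm lam]
    rw [h2, inner_smul_right, inner_sqrtC₀, mul_inv_cancel_left₀ hn.ne', mul_comm,
      map_smul] at h1
    exact mul_left_cancel₀ (Real.sqrt_pos.2 (S.κ_pos k)).ne' h1
  · rintro ⟨hw, hx⟩
    obtain ⟨h, rfl⟩ := memScale_one_iff.1 hw
    have h1 : S.sqrtC₀ x = n • (adjoint L (L h) + lam • h) := by
      refine S.φ.ext_inner fun k => ?_
      rw [inner_smul_right, ← key, hx, inner_sqrtC₀, mul_comm]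
      rfl
    simp only [smul_apply, ContinuousLinearMap.comp_apply, h1, map_smul, hR',
      inv_smul_smul₀ hn.ne']

/-- For `w = C₀^(1/2) x` and `v = C₀^(1/2) g`, the weak equation reads `⟪(L*L + lam) x, g⟫ = ⟪q, g⟫`
for all `g` in `X`. -/
lemma isWeakSolution_iff {r : ℕ → ℝ} {q : X} (hq : ∀ k, ⟪S.φ k, q⟫ = √(S.κ k) * r k) (w : X) :
    S.IsWeakSolution lam r w ↔ w = S.sqrtC₀ (R q) := by
  have key : ∀ g, ∑' k, r k * S.coeff (S.sqrtC₀ g) k = ⟪q, g⟫ := by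
    intro g
    rw [← S.φ.tsum_inner_mul_inner]
    refine tsum_congr fun k => ?_
    rw [coeff, inner_sqrtC₀, real_inner_comm _ q, hq]
    ring
  constructor
  · rintro ⟨hw, h⟩
    obtain ⟨x, rfl⟩ := memScale_one_iff.1 hw
    have : adjoint L (L x) + lam • x = q := by
      refine ext_inner_right ℝ fun g => ?_
      rw [← B_sqrtC₀ hL, h _ (memScale_one_iff.2 ⟨g, rfl⟩), key]
    rw [← this, hR']
  · rintro rfl
    refine ⟨memScale_one_iff.2 ⟨_, rfl⟩, fun v hv => ?_⟩
    obtain ⟨g, rfl⟩ := memScale_one_iff.1 hv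
    rw [B_sqrtC₀ hL, hR, key]

end Resolvent

end Forward

end BayesInverse.Setting

/-! ### The data space, the extension of `A⁻¹ C₁⁻¹`, and the expansion of `L h`. -/

namespace BayesInverse.Setting

variable {X : Type*} [NormedAddCommGroup X] [InnerProductSpace ℝ X] [CompleteSpace X]
  {S : Setting X} {s₀ β ℓ c₁ c₂ c₃ c₄ : ℝ}

open ContinuousLinearMap (adjoint)

lemma rpow_neg_neg_one_half (k : ℕ) : S.κ k ^ (-(-1 : ℝ) / 2) = √(S.κ k) := by
  rw [Real.sqrt_eq_rpow]; norm_num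

section Noise

/-- `C₁^(1/2)` is a Hilbert–Schmidt operator from `X` to the space `X^a` of the data. -/
lemma Assumptions.summable_noise (hS : S.Assumptions s₀ β ℓ c₁ c₂ c₃ c₄) :
    Summable fun k => S.κ k ^ (-(2 * β - 2 * ℓ - 1)) * ‖S.sqrtC₁ (S.φ k)‖ ^ 2 := by
  -- The assumption on `2 * ℓ - β + 1` leaves room for an admissible `ρ` above the data exponent; `ρ
  -- < β - s₀` makes `C₀^(β-ρ)` trace class.
  obtain ⟨ρ, hρ, hρ₁, hρ₂⟩ : ∃ ρ : ℝ, 2 * β - 2 * ℓ - 1 ≤ ρ ∧ (⌈β - s₀ - 1⌉ : ℝ) ≤ ρ ∧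
      ρ < β - s₀ := by
    refine ⟨max (2 * β - 2 * ℓ - 1) ⌈β - s₀ - 1⌉, le_max_left _ _, le_max_right _ _, max_lt ?_ ?_⟩
    · linarith [hS.delta, hS.s₀_nonneg]
    · linarith [Int.ceil_lt_add_one (β - s₀ - 1)]
  refine S.summable_rpow_mul_of_le hρ (fun k => sq_nonneg _) ?_
  have hnn : ∀ p : ℕ × ℕ, 0 ≤ S.κ p.2 ^ (-ρ) * ⟪S.φ p.2, S.sqrtC₁ (S.φ p.1)⟫ ^ 2 := fun p =>
    mul_nonneg (Real.rpow_nonneg (S.κ_pos _).le _) (sq_nonneg _)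
  have hsum : Summable fun p : ℕ × ℕ => S.κ p.2 ^ (-ρ) * ⟪S.φ p.2, S.sqrtC₁ (S.φ p.1)⟫ ^ 2 := by
    rw [summable_prod_of_nonneg hnn]
    refine ⟨fun j => (hS.sqrtC₁_bound ρ hρ₁ hρ₂ _ (basis_mem_smooth j)).1, ?_⟩
    refine Summable.of_nonneg_of_le (fun j => tsum_nonneg fun k => hnn (j, k)) (fun j => ?_)
      ((hS.trace (β - ρ) (by linarith)).mul_left (c₁ ^ 2))
    have h1 := (hS.sqrtC₁_bound ρ hρ₁ hρ₂ _ (basis_mem_smooth j)).2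
    have h2 := scaleNorm_sum_smul_sq (S := S) {j} (fun _ => 1) (ρ - β)
    simp only [Finset.sum_singleton, one_smul, one_pow, mul_one, neg_sub] at h2
    have h3 := pow_le_pow_left₀ (scaleNorm_nonneg _ _) h1 2
    rwa [mul_pow, h2, scaleNorm_sq] at h3
  -- The Hilbert–Schmidt double sum is first bounded by rows in the `X^ρ` norm; summed the other
  -- way, it gives the claim by symmetry of `sqrtC₁`.
  have hswap := hsum.prod_symm.prod
  refine hswap.congr fun k => ?_
  have h := (S.φ.hasSum_inner_sq (S.sqrtC₁ (S.φ k))).mul_left (S.κ k ^ (-ρ))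
  rw [← h.tsum_eq]
  refine tsum_congr fun j => ?_
  simp only [Prod.fst_swap, Prod.snd_swap]
  rw [← inner_sqrtC₁_left, real_inner_comm]

end Noise

section Data

variable {L : X →L[ℝ] X} (hL : ∀ h, S.sqrtC₁ (L h) = S.Ainv (S.sqrtC₀ h))

include hL

lemma Assumptions.norm_adjoint_invSqrtC₁_le (hS : S.Assumptions s₀ β ℓ c₁ c₂ c₃ c₄) {p : X}
    (hp : p ∈ S.smooth) :
    ‖adjoint L (S.invSqrtC₁ p)‖ ≤ c₄ * S.scaleNorm (2 * β - 2 * ℓ - 1) (S.coeff p) := by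
  have h := (hS.AinvC₁inv_bound 1 (by linarith [hS.delta, hS.s₀_nonneg]) le_rfl p hp).2
  rwa [scaleNorm_eq_norm (x := adjoint L (S.invSqrtC₁ p))] at h
  intro k
  rw [hS.inner_adjoint_invSqrtC₁ hL, rpow_neg_neg_one_half]

lemma Assumptions.norm_sum_smul_sq_le (hS : S.Assumptions s₀ β ℓ c₁ c₂ c₃ c₄) (y : ℕ → ℝ)
    (F : Finset ℕ) :
    ‖∑ i ∈ F, y i • adjoint L (S.invSqrtC₁ (S.φ i))‖ ^ 2 ≤
      c₄ ^ 2 * ∑ i ∈ F, S.κ i ^ (-(2 * β - 2 * ℓ - 1)) * y i ^ 2 := by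
  have h := hS.norm_adjoint_invSqrtC₁_le hL (sum_smul_mem_smooth F y)
  rw [invSqrtC₁_sum_smul hS.basis_mem, map_sum] at h
  simp only [map_smul] at h
  rw [← scaleNorm_sum_smul_sq, ← mul_pow]
  gcongr

lemma Assumptions.summable_data (hS : S.Assumptions s₀ β ℓ c₁ c₂ c₃ c₄) {y : ℕ → ℝ}
    (hy : S.MemScale (2 * β - 2 * ℓ - 1) y) :
    Summable fun i => y i • adjoint L (S.invSqrtC₁ (S.φ i)) :=
  summable_of_norm_sum_sq_le hy fun F => hS.norm_sum_smul_sq_le hL y F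

/-- The extension of `A⁻¹ C₁⁻¹` by continuity is given by a convergent series. -/
lemma Assumptions.isAinvC₁inv_iff (hS : S.Assumptions s₀ β ℓ c₁ c₂ c₃ c₄) {y r : ℕ → ℝ} {q : X}
    (hy : S.MemScale (2 * β - 2 * ℓ - 1) y)
    (hq : HasSum (fun i => y i • adjoint L (S.invSqrtC₁ (S.φ i))) q)
    (hr : ∀ k, ⟪S.φ k, q⟫ = √(S.κ k) * r k) (r' : ℕ → ℝ) :
    S.IsAinvC₁inv (2 * β - 2 * ℓ - 1) y r' ↔ r' = r := by
  set a := 2 * β - 2 * ℓ - 1 with ha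
  obtain ⟨y', hy'⟩ := hy.exists_inner_eq
  let p : ℕ → X := fun j => ∑ i ∈ Finset.range j, y i • S.φ i
  let p' : ℕ → X := fun j => ∑ i ∈ Finset.range j, ⟪S.φ i, y'⟫ • S.φ i
  have hp : ∀ j, p j ∈ S.smooth := fun j => sum_smul_mem_smooth _ _
  have hp' : Tendsto p' atTop (𝓝 y') := (S.φ.hasSum_smul y').tendsto_sum_nat
  have hpp : ∀ j k, ⟪S.φ k, p' j⟫ = S.κ k ^ (-a / 2) * S.coeff (p j) k := by
    intro j k
    simp only [p, p', coeff, S.φ.inner_sum_smul, hy']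
    split_ifs <;> simp
  have hLp : Tendsto (fun j => adjoint L (S.invSqrtC₁ (p j))) atTop (𝓝 q) := by
    refine hq.tendsto_sum_nat.congr fun j => ?_
    simp only [p, invSqrtC₁_sum_smul hS.basis_mem, map_sum, map_smul]
  have hnorm : ∀ (x z : X) (r : ℕ → ℝ), (∀ k, ⟪S.φ k, z⟫ = √(S.κ k) * r k) →
      S.scaleNorm (-1) (S.AinvC₁inv x - r) = ‖adjoint L (S.invSqrtC₁ x) - z‖ := by
    intro x z r hr
    refine scaleNorm_eq_norm fun k => ?_
    rw [inner_sub_right, hS.inner_adjoint_invSqrtC₁ hL, hr, rpow_neg_neg_one_half, Pi.sub_apply]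
    ring
  constructor
  · rintro ⟨-, hr', u, hu, hu₁, hu₂⟩
    obtain ⟨q', hq'⟩ := hr'.exists_inner_eq
    simp only [rpow_neg_neg_one_half] at hq'
    simp only [hnorm _ _ _ hq'] at hu₂
    have hq₂ : Tendsto (fun j => adjoint L (S.invSqrtC₁ (u j))) atTop (𝓝 q') :=
      tendsto_iff_norm_sub_tendsto_zero.2 hu₂
    choose u' hu' using fun j => (memScale_of_mem_smooth (hu j) a).exists_inner_eq
    have h1 : Tendsto u' atTop (𝓝 y') := by
      refine tendsto_iff_norm_sub_tendsto_zero.2 (hu₁.congr fun j => ?_)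
      refine scaleNorm_eq_norm fun k => ?_
      rw [inner_sub_right, hu', hy', Pi.sub_apply]
      ring
    have h2 : Tendsto (fun j => c₄ * ‖u' j - p' j‖) atTop (𝓝 0) := by
      simpa using (h1.sub hp').norm.const_mul c₄
    -- Uniqueness of the extension: two smooth approximations of `y` differ by a null sequence in
    -- `X^a`, hence so do their images.
    have h3 : Tendsto (fun j => adjoint L (S.invSqrtC₁ (u j)) - adjoint L (S.invSqrtC₁ (p j)))
        atTop (𝓝 0) := by
      refine squeeze_zero_norm (fun j => ?_) h2
      have h4 : S.invSqrtC₁ (u j - p j) = S.invSqrtC₁ (u j) - S.invSqrtC₁ (p j) := by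
        refine invSqrtC₁_eq ?_
        rw [map_sub, sqrtC₁_invSqrtC₁ (hS.invSqrtC₁_bound.1 _ (hu j)),
          sqrtC₁_invSqrtC₁ (hS.invSqrtC₁_bound.1 _ (hp j))]
      have h5 := hS.norm_adjoint_invSqrtC₁_le hL (sub_mem_smooth (hu j) (hp j))
      rwa [h4, map_sub, scaleNorm_eq_norm (x := u' j - p' j)] at h5
      intro k
      rw [inner_sub_right, hu', hpp, coeff, coeff, coeff, inner_sub_right]
      ring
    have h6 : q' = q := sub_eq_zero.1 (tendsto_nhds_unique (hq₂.sub hLp) h3)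
    funext k
    refine mul_left_cancel₀ (Real.sqrt_pos.2 (S.κ_pos k)).ne' ?_
    rw [← hq', ← hr, h6]
  · rintro rfl
    refine ⟨hy, memScale_of_inner_eq (x := q) fun k => ?_, p, hp, ?_, ?_⟩
    · rw [hr, rpow_neg_neg_one_half]
    · refine (tendsto_iff_norm_sub_tendsto_zero.1 hp').congr fun j => ?_
      refine (scaleNorm_eq_norm fun k => ?_).symm
      rw [inner_sub_right, hpp, hy', Pi.sub_apply]
      ring
    · simp only [hnorm _ _ _ hr]
      exact tendsto_iff_norm_sub_tendsto_zero.1 hLp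

/-- Duality: the map `y ↦ ∑ yᵢ L* C₁^(-1/2) φᵢ` is bounded on `X^a`, so its adjoint sends `h` to a
sequence in `X^(-a)`. Testing with `yᵢ = κᵢ^a dᵢ` on `F` yields `s² ≤ c₄² s ‖h‖²` for the partial
sum `s`. -/
lemma Assumptions.summable_inner_sq (hS : S.Assumptions s₀ β ℓ c₁ c₂ c₃ c₄) (h : X) :
    Summable fun i => S.κ i ^ (2 * β - 2 * ℓ - 1) * ⟪adjoint L (S.invSqrtC₁ (S.φ i)), h⟫ ^ 2 := by
  set a := 2 * β - 2 * ℓ - 1 with ha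
  set d : ℕ → ℝ := fun i => ⟪adjoint L (S.invSqrtC₁ (S.φ i)), h⟫ with hd
  have hnn : ∀ i, 0 ≤ S.κ i ^ a * d i ^ 2 := fun i =>
    mul_nonneg (Real.rpow_nonneg (S.κ_pos _).le _) (sq_nonneg _)
  refine summable_of_sum_le (c := c₄ ^ 2 * ‖h‖ ^ 2) hnn fun F => ?_
  set s := ∑ i ∈ F, S.κ i ^ a * d i ^ 2
  have hs : 0 ≤ s := Finset.sum_nonneg fun i _ => hnn i
  have h1 := hS.norm_sum_smul_sq_le hL (fun i => S.κ i ^ a * d i) F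
  have h2 : ∑ i ∈ F, S.κ i ^ (-a) * (S.κ i ^ a * d i) ^ 2 = s := by
    refine Finset.sum_congr rfl fun i _ => ?_
    have : S.κ i ^ (-a) * S.κ i ^ a = 1 := by rw [← Real.rpow_add (S.κ_pos i)]; simp
    linear_combination S.κ i ^ a * d i ^ 2 * this
  have h3 : ⟪∑ i ∈ F, (S.κ i ^ a * d i) • adjoint L (S.invSqrtC₁ (S.φ i)), h⟫ = s := by
    rw [sum_inner]
    refine Finset.sum_congr rfl fun i _ => ?_
    rw [real_inner_smul_left]
    simp only [hd]
    ring
  have h4 := real_inner_le_norm (∑ i ∈ F, (S.κ i ^ a * d i) • adjoint L (S.invSqrtC₁ (S.φ i))) h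
  rw [h2] at h1
  rw [h3] at h4
  have h5 : s ^ 2 ≤ (c₄ ^ 2 * s) * ‖h‖ ^ 2 := by
    calc s ^ 2 ≤ (‖_‖ * ‖h‖) ^ 2 := pow_le_pow_left₀ hs h4 2
      _ ≤ _ := by rw [mul_pow]; gcongr
  rcases hs.eq_or_lt with h6 | h6
  · rw [← h6]; positivity
  · nlinarith

/-- The estimate is available on smooth vectors, so `h` is truncated; the uniform bound on finite
partial sums survives the limit. -/
lemma Assumptions.memScale_forward (hS : S.Assumptions s₀ β ℓ c₁ c₂ c₃ c₄) {s : ℝ} (hs₀ : s₀ < s)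
    (hs₁ : s ≤ 1) (hs : s + β - 2 * ℓ ≤ 1) (h : X) : S.MemScale s (S.coeff (L h)) := by
  set g := S.sqrtC₀ h with hg
  have hgm : S.MemScale (s + β - 2 * ℓ) (S.coeff g) := (memScale_one_iff.2 ⟨h, rfl⟩).of_le hs
  let hj : ℕ → X := fun j => ∑ i ∈ Finset.range j, ⟪S.φ i, h⟫ • S.φ i
  have hj_lim : Tendsto (fun j => L (hj j)) atTop (𝓝 (L h)) :=
    (L.continuous.tendsto h).comp (S.φ.hasSum_smul h).tendsto_sum_nat
  have hj_eq : ∀ j, S.sqrtC₀ (hj j) = ∑ i ∈ Finset.range j, S.coeff g i • S.φ i := by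
    intro j
    simp only [hj, map_sum, map_smul, sqrtC₀_basis, smul_smul, hg, coeff, inner_sqrtC₀]
    exact Finset.sum_congr rfl fun i _ => by rw [mul_comm]
  have hbound : ∀ (j : ℕ) (F : Finset ℕ), ∑ k ∈ F, S.κ k ^ (-s) * S.coeff (L (hj j)) k ^ 2 ≤
      c₃ ^ 2 * ∑' k, S.κ k ^ (-(s + β - 2 * ℓ)) * S.coeff g k ^ 2 := by
    intro j F
    have h1 := hS.invSqrtC₁_Ainv_bound s hs₀ hs₁ (S.sqrtC₀ (hj j))
      (by rw [hj_eq]; exact sum_smul_mem_smooth _ _)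
    rw [invSqrtC₁_Ainv_sqrtC₀ hL] at h1
    have h2 := pow_le_pow_left₀ (scaleNorm_nonneg _ _) h1.2 2
    rw [mul_pow, hj_eq, scaleNorm_sum_smul_sq, scaleNorm_sq] at h2
    calc _ ≤ _ := h1.1.sum_le_tsum F fun k _ =>
          mul_nonneg (Real.rpow_nonneg (S.κ_pos _).le _) (sq_nonneg _)
      _ ≤ _ := h2
      _ ≤ _ := by
        gcongr
        exact hgm.sum_le_tsum _ fun k _ =>
          mul_nonneg (Real.rpow_nonneg (S.κ_pos _).le _) (sq_nonneg _)
  refine summable_of_sum_le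
    (c := c₃ ^ 2 * ∑' k, S.κ k ^ (-(s + β - 2 * ℓ)) * S.coeff g k ^ 2)
    (fun k => mul_nonneg (Real.rpow_nonneg (S.κ_pos _).le _) (sq_nonneg _)) fun F => ?_
  refine le_of_tendsto' (f := fun j => ∑ k ∈ F, S.κ k ^ (-s) * S.coeff (L (hj j)) k ^ 2)
    (x := atTop) ?_ fun j => hbound j F
  refine tendsto_finsetSum _ fun k _ => Tendsto.const_mul _ (Tendsto.pow ?_ 2)
  exact Tendsto.inner tendsto_const_nhds hj_lim

/-- The vector `C₁^(-1/2) A⁻¹ C₀^(1/2) h`, expanded into the images under `C₁^(1/2)` of the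
eigenbasis. -/
lemma Assumptions.hasSum_forward (hS : S.Assumptions s₀ β ℓ c₁ c₂ c₃ c₄) (h : X) :
    HasSum (fun i => ⟪adjoint L (S.invSqrtC₁ (S.φ i)), h⟫ • S.sqrtC₁ (S.φ i)) (L h) := by
  set d : ℕ → ℝ := fun i => ⟪adjoint L (S.invSqrtC₁ (S.φ i)), h⟫ with hd
  have hsum : Summable fun i => d i • S.sqrtC₁ (S.φ i) := by
    -- Absolute convergence by `2xy ≤ x² + y²`, with the weights `κᵢ^(t/2)` and `κᵢ^(-t/2)`
    -- balancing the dual bound against the Hilbert–Schmidt bound.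
    refine Summable.of_norm_bounded ((hS.summable_inner_sq hL h).add hS.summable_noise) fun i => ?_
    set t := 2 * β - 2 * ℓ - 1
    have h2 := S.rpow_half_sq t i
    have h3 := S.rpow_half_sq (-t) i
    have h4 : S.κ i ^ (t / 2) * S.κ i ^ (-t / 2) = 1 := by
      rw [← Real.rpow_add (S.κ_pos i), neg_div, add_neg_cancel, Real.rpow_zero]
    have h5 : S.κ i ^ t * d i ^ 2 = (S.κ i ^ (t / 2) * |d i|) ^ 2 := by
      rw [mul_pow, h2, sq_abs]
    have h6 : S.κ i ^ (-t) * ‖S.sqrtC₁ (S.φ i)‖ ^ 2 =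
        (S.κ i ^ (-t / 2) * ‖S.sqrtC₁ (S.φ i)‖) ^ 2 := by
      rw [mul_pow, h3]
    rw [norm_smul, Real.norm_eq_abs]
    change _ ≤ S.κ i ^ t * d i ^ 2 + _
    rw [h5, h6]
    have h7 : |d i| * ‖S.sqrtC₁ (S.φ i)‖ =
        (S.κ i ^ (t / 2) * |d i|) * (S.κ i ^ (-t / 2) * ‖S.sqrtC₁ (S.φ i)‖) := by
      linear_combination -(|d i| * ‖S.sqrtC₁ (S.φ i)‖) * h4
    rw [h7]
    nlinarith [sq_nonneg (S.κ i ^ (t / 2) * |d i| - S.κ i ^ (-t / 2) * ‖S.sqrtC₁ (S.φ i)‖),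
      sq_nonneg (S.κ i ^ (t / 2) * |d i|), sq_nonneg (S.κ i ^ (-t / 2) * ‖S.sqrtC₁ (S.φ i)‖)]
  -- One exponent must serve three estimates: `L h ∈ X^s`, `C₁^(1/2) φₖ ∈ X^(β-s)`, and `C₁^(-1/2)`
  -- bounded from `X^(β-s)` to `X^(-s)`.
  obtain ⟨s, hs₀, hs₁, hs, hsρ⟩ : ∃ s : ℝ, s₀ < s ∧ s ≤ 1 ∧ s + β - 2 * ℓ ≤ 1 ∧
      (⌈β - s₀ - 1⌉ : ℝ) ≤ β - s := by
    refine ⟨min 1 (min (2 * ℓ - β + 1) (β - ⌈β - s₀ - 1⌉)), lt_min hS.s₀_lt_one (lt_min ?_ ?_),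
      min_le_left _ _, ?_, ?_⟩
    · linarith [hS.delta, hS.s₀_nonneg]
    · linarith [Int.ceil_lt_add_one (β - s₀ - 1)]
    · linarith [(min_le_right (1 : ℝ) _).trans (min_le_left (2 * ℓ - β + 1) (β - ⌈β - s₀ - 1⌉))]
    · linarith [(min_le_right (1 : ℝ) _).trans (min_le_right (2 * ℓ - β + 1) (β - ⌈β - s₀ - 1⌉))]
  obtain ⟨z, hz⟩ := hsum
  suffices z = L h by rwa [← this]
  refine S.φ.ext_inner fun k => ?_
  -- The `k`-th coefficient of the partial sums is `⟪C₁^(-1/2) pⱼ, L h⟫`, with `pⱼ` the truncations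
  -- of `p`. Formally `C₁^(-1/2) pⱼ → φₖ`; this holds weakly in `X^(-s)`, which suffices against `L
  -- h ∈ X^s`.
  set p := S.sqrtC₁ (S.φ k) with hp
  obtain ⟨hpm, -⟩ := hS.sqrtC₁_bound (β - s) hsρ (by linarith) _ (basis_mem_smooth k)
  let pj : ℕ → X := fun j => ∑ i ∈ Finset.range j, ⟪S.φ i, p⟫ • S.φ i
  have hpj : ∀ j, pj j ∈ S.smooth := fun j => sum_smul_mem_smooth _ _
  have hpj_lim : Tendsto pj atTop (𝓝 p) := (S.φ.hasSum_smul p).tendsto_sum_nat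
  obtain ⟨x', hx'⟩ := (hS.memScale_forward hL hs₀ hs₁ hs h).exists_inner_eq
  have hneg : ∀ x : X, S.MemScale (-s) (S.coeff x) := fun x =>
    (memScale_coeff_zero x).of_le (by linarith [hS.s₀_nonneg])
  -- `e x` is `C₀^(s/2) x` and `x'` is `C₀^(-s/2) L h`: the duality of `X^(-s)` and `X^s` becomes an
  -- inner product in `X`.
  choose e he using fun x => (hneg x).exists_inner_eq
  have hinner : ∀ x, ⟪e x, x'⟫ = ⟪x, L h⟫ := by
    intro x
    rw [← S.φ.tsum_inner_mul_inner, ← S.φ.tsum_inner_mul_inner]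
    refine tsum_congr fun i => ?_
    have : S.κ i ^ (-(-s) / 2) * S.κ i ^ (-s / 2) = 1 := by
      rw [← Real.rpow_add (S.κ_pos i), neg_neg, neg_div, add_neg_cancel, Real.rpow_zero]
    rw [real_inner_comm _ (e x), he, hx', coeff, coeff, real_inner_comm _ x]
    linear_combination ⟪S.φ i, x⟫ * ⟪S.φ i, L h⟫ * this
  have hbound : ∀ j, ‖e (S.invSqrtC₁ (pj j))‖ ≤ c₂ * S.scaleNorm (β - s) (S.coeff p) := by
    intro j
    rw [← scaleNorm_eq_norm (he _)]
    refine (hS.invSqrtC₁_bound.2 s hs₀ hs₁ _ (hpj j)).trans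
      (mul_le_mul_of_nonneg_left ?_ hS.c₂_pos.le)
    refine le_of_sq_le_sq ?_ (scaleNorm_nonneg _ _)
    rw [scaleNorm_sum_smul_sq, scaleNorm_sq]
    exact hpm.sum_le_tsum _ fun k _ =>
      mul_nonneg (Real.rpow_nonneg (S.κ_pos _).le _) (sq_nonneg _)
  have hcoord : ∀ i, Tendsto (fun j => ⟪S.φ i, e (S.invSqrtC₁ (pj j))⟫) atTop
      (𝓝 ⟪S.φ i, e (S.φ k)⟫) := by
    intro i
    have hi : ∀ x, ⟪S.φ i, x⟫ = ⟪S.sqrtC₁ x, S.invSqrtC₁ (S.φ i)⟫ := fun x => by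
      rw [inner_sqrtC₁_left, sqrtC₁_invSqrtC₁ (hS.basis_mem i), real_inner_comm]
    simp only [he, coeff]
    refine Tendsto.const_mul _ ?_
    simp only [hi, sqrtC₁_invSqrtC₁ (hS.invSqrtC₁_bound.1 _ (hpj _))]
    exact hpj_lim.inner tendsto_const_nhds
  have hweak := S.φ.tendsto_inner_of_bounded hbound hcoord x'
  simp only [hinner] at hweak
  refine tendsto_nhds_unique ?_ hweak
  refine ((tendsto_const_nhds (x := S.φ k)).inner hz.tendsto_sum_nat).congr fun j => ?_
  simp only [pj, invSqrtC₁_sum_smul hS.basis_mem, inner_sum, sum_inner, real_inner_smul_left,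
    inner_smul_right, hd, ContinuousLinearMap.adjoint_inner_left]
  refine Finset.sum_congr rfl fun i _ => ?_
  rw [← inner_sqrtC₁_left, real_inner_comm (S.φ i)]
  ring

end Data

end BayesInverse.Setting

/-! ### Conditional laws and limits of characteristic functions. -/

section Probability

variable {Ω : Type*} [MeasurableSpace Ω] {P : Measure Ω} [IsProbabilityMeasure P]

/-- If `u - m(Y)` is independent of `Y`, then the conditional law of `u` given `Y = y` is the law of
`u - m(Y)`, translated by `m(y)`. -/
lemma condDistrib_ae_eq_map_add {β X : Type*} [MeasurableSpace β] [AddCommGroup X]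
    [MeasurableSpace X] [MeasurableAdd₂ X] [StandardBorelSpace X] [Nonempty X]
    {Y : Ω → β} {u Z : Ω → X} {m : β → X} (hY : Measurable Y) (hu : Measurable u)
    (hZ : Measurable Z) (hm : Measurable m) (huZ : ∀ ω, u ω = m (Y ω) + Z ω)
    (hind : IndepFun Z Y P) :
    ∀ᵐ y ∂(P.map Y), condDistrib u Y P y = (P.map Z).map fun z => m y + z := by
  have hf : Measurable fun p : β × X => m p.1 + p.2 := by fun_prop
  have : IsProbabilityMeasure (P.map Z) := Measure.isProbabilityMeasure_map hZ.aemeasurable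
  have : IsProbabilityMeasure (P.map Y) := Measure.isProbabilityMeasure_map hY.aemeasurable
  -- `K y` is the law of `m y + Z`; uniqueness of disintegration identifies it with the conditional
  -- law.
  let K : Kernel β X := (Kernel.id ×ₖ Kernel.const β (P.map Z)).map fun p => m p.1 + p.2
  have : IsFiniteKernel K := by dsimp only [K]; infer_instance
  have hK : ∀ y, K y = (P.map Z).map fun z => m y + z := by
    intro y
    rw [Kernel.map_apply _ hf, Kernel.prod_apply, Kernel.id_apply, Kernel.const_apply,
      Measure.dirac_prod, Measure.map_map hf measurable_prodMk_left]
    rfl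
  have hg : Measurable fun p : β × X => (p.1, m p.1 + p.2) := by fun_prop
  have hprod : P.map (fun ω => (Y ω, Z ω)) = (P.map Y).prod (P.map Z) :=
    (indepFun_iff_map_prod_eq_prod_map_map hY.aemeasurable hZ.aemeasurable).1 hind.symm
  have heq : P.map (fun ω => (Y ω, u ω)) = P.map Y ⊗ₘ K := by
    ext s hs
    rw [Measure.compProd_apply hs]
    have h1 : P.map (fun ω => (Y ω, u ω)) =
        (P.map fun ω => (Y ω, Z ω)).map fun p : β × X => (p.1, m p.1 + p.2) := by
      rw [Measure.map_map hg (by fun_prop)]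
      congr 1
      funext ω
      simp [huZ]
    rw [h1, hprod, Measure.map_apply hg hs, Measure.prod_apply (hg hs)]
    refine lintegral_congr fun y => ?_
    rw [hK, Measure.map_apply (by fun_prop) (measurable_prodMk_left hs)]
    rfl
  filter_upwards [condDistrib_ae_eq_of_measure_eq_compProd_of_measurable hY hu heq] with y hy
  rw [hy, hK]

omit [IsProbabilityMeasure P] in
lemma charFun_map_one {f : Ω → ℝ} (hf : Measurable f) :
    charFun (P.map f) 1 = ∫ ω, Complex.exp (f ω * Complex.I) ∂P := by
  rw [charFun_apply_real, integral_map hf.aemeasurable (by fun_prop)]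
  simp

/-- Dominated convergence with bound `1`. The argument `1` suffices, since scalings are absorbed
into the functionals. -/
lemma tendsto_charFun_map_one {f : ℕ → Ω → ℝ} {g : Ω → ℝ} (hf : ∀ j, Measurable (f j))
    (hg : Measurable g) (h : ∀ᵐ ω ∂P, Tendsto (fun j => f j ω) atTop (𝓝 (g ω))) :
    Tendsto (fun j => charFun (P.map (f j)) 1) atTop (𝓝 (charFun (P.map g) 1)) := by
  simp only [charFun_map_one (hf _), charFun_map_one hg]
  refine tendsto_integral_of_dominated_convergence (fun _ => 1) (fun j => ?_)
    (integrable_const _) (fun j => ?_) ?_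
  · have := hf j
    exact Measurable.aestronglyMeasurable (by fun_prop)
  · exact Eventually.of_forall fun ω => by rw [Complex.norm_exp_ofReal_mul_I]
  · filter_upwards [h] with ω hω
    have hc : Continuous fun x : ℝ => Complex.exp (x * Complex.I) := by fun_prop
    exact (hc.tendsto _).comp hω

lemma memLp_continuousLinear_of_isGaussian {E : Type*} [TopologicalSpace E] [AddCommMonoid E]
    [Module ℝ E] [MeasurableSpace E] [OpensMeasurableSpace E] (μ : Measure E) [IsGaussian μ]
    (f : StrongDual ℝ E) : MemLp f 2 μ := by
  suffices MemLp (id ∘ f) 2 μ from this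
  rw [← memLp_map_measure_iff (by fun_prop) (by fun_prop), IsGaussian.map_eq_gaussianReal f]
  exact memLp_id_gaussianReal 2

end Probability

/-! ### Gaussian laws of the prior, the noise and the data. -/

namespace BayesInverse

lemma IsGaussianWith.map_const_add {X : Type*} [NormedAddCommGroup X] [InnerProductSpace ℝ X]
    [CompleteSpace X] [SecondCountableTopology X] [MeasurableSpace X] [BorelSpace X]
    {μ : Measure X} {C : X →L[ℝ] X} (h : IsGaussianWith μ 0 C) (m : X) :
    IsGaussianWith (μ.map fun x => m + x) m C := by
  obtain ⟨h₁, h₂, h₃⟩ := h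
  refine ⟨inferInstance, ?_, fun v w => ?_⟩
  · have hid : Integrable (fun x => x) μ := IsGaussian.integrable_id
    rw [integral_map (by fun_prop) (by fun_prop), integral_add (integrable_const _) hid, h₂]
    simp
  · rw [covarianceBilin_map_const_add, h₃]

lemma isGaussianWith_zero_of_charFun {X : Type*} [NormedAddCommGroup X] [InnerProductSpace ℝ X]
    [CompleteSpace X] [SecondCountableTopology X] [MeasurableSpace X] [BorelSpace X]
    {μ : Measure X} [IsFiniteMeasure μ] {C : X →L[ℝ] X} (hC : PositiveDefinite C)
    (h : ∀ v, charFun μ v = Complex.exp (-(⟪C v, v⟫ / 2 : ℝ))) : IsGaussianWith μ 0 C := by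
  let f : X →L[ℝ] X →L[ℝ] ℝ := (innerSL ℝ).comp C
  have hf : f.toBilinForm.IsPosSemidef := by
    refine ⟨⟨fun x y => ?_⟩, ⟨fun x => ?_⟩⟩
    · change ⟪C x, y⟫ = ⟪C y, x⟫
      rw [hC.1, real_inner_comm]
    · change 0 ≤ ⟪C x, x⟫
      rcases eq_or_ne x 0 with rfl | hx
      · simp
      · exact (hC.2 x hx).le
  have hμ : ∀ t, charFun μ t = Complex.exp ((⟪t, (0 : X)⟫ : ℝ) * Complex.I - (f t t : ℝ) / 2) := by
    intro t
    rw [h, inner_zero_right]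
    congr 1
    change _ = _ - ((⟪C t, t⟫ : ℝ) : ℂ) / 2
    push_cast
    ring
  have hG := isGaussian_iff_gaussian_charFun.2 ⟨0, f, hf, hμ⟩
  obtain ⟨h₁, h₂⟩ := gaussian_charFun_congr 0 f hf hμ
  refine ⟨hG, h₁.symm, fun v w => ?_⟩
  rw [← h₂]
  rfl

namespace Setting

variable {X : Type*} [NormedAddCommGroup X] [InnerProductSpace ℝ X] [CompleteSpace X]
  [SecondCountableTopology X] [MeasurableSpace X] [BorelSpace X]
  {S : Setting X} {s₀ β ℓ c₁ c₂ c₃ c₄ : ℝ} {n τ : ℝ}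
  {Ω : Type*} [MeasurableSpace Ω] {P : Measure Ω} [IsProbabilityMeasure P]
  {u : Ω → X} {ξ : Ω → ℕ → ℝ}

open ContinuousLinearMap (adjoint)

omit [SecondCountableTopology X] [IsProbabilityMeasure P] in
lemma measurable_data (hu : Measurable u) (hξ : Measurable ξ) : Measurable (S.data n u ξ) := by
  refine measurable_pi_lambda _ fun k => Measurable.add ?_ ?_
  · have : Continuous fun x : X => ⟪S.φ k, S.Ainv x⟫ := by fun_prop
    exact this.measurable.comp hu
  · exact ((measurable_pi_apply k).comp hξ).const_mul _

omit [IsProbabilityMeasure P] in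
lemma charFun_prior (hu : Measurable u) (hu_law : IsGaussianWith (P.map u) 0 (τ ^ 2 • S.C₀))
    (x : X) : charFun (P.map fun ω => ⟪u ω, x⟫) 1 =
      Complex.exp (-(τ ^ 2 * ‖S.sqrtC₀ x‖ ^ 2 / 2 : ℝ)) := by
  obtain ⟨h₁, h₂, h₃⟩ := hu_law
  have h := h₁.charFun_eq' x
  simp only [id] at h
  rw [h₂, h₃, smul_apply, real_inner_smul_left, inner_C₀, inner_zero_right, charFun_apply,
    integral_map hu.aemeasurable (by fun_prop)] at h
  rw [charFun_map_one (by fun_prop), h]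
  congr 1
  push_cast
  ring

omit [SecondCountableTopology X] [MeasurableSpace X] [BorelSpace X] [IsProbabilityMeasure P] in
lemma charFun_noise (hξ : Measurable ξ) (hξ_law : S.IsNoiseLaw (P.map ξ)) (F : Finset ℕ)
    (b : ℕ → ℝ) : charFun (P.map fun ω => ∑ i ∈ F, b i * ξ ω i) 1 =
      Complex.exp (-(‖S.sqrtC₁ (∑ i ∈ F, b i • S.φ i)‖ ^ 2 / 2 : ℝ)) := by
  obtain ⟨h₁, h₂, h₃⟩ := hξ_law
  let f : StrongDual ℝ (ℕ → ℝ) := ∑ i ∈ F, b i • ContinuousLinearMap.proj i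
  have hf : ∀ a, f a = ∑ i ∈ F, b i * a i := fun a => by simp [f]
  have hmem : ∀ i, MemLp (fun a : ℕ → ℝ => a i) 2 (P.map ξ) := fun i =>
    memLp_continuousLinear_of_isGaussian (P.map ξ) (ContinuousLinearMap.proj i)
  have hmean : ∫ a, f a ∂(P.map ξ) = 0 := by
    simp only [hf]
    rw [integral_finsetSum _ fun i _ => ((hmem i).integrable (by norm_num)).const_mul _]
    simp only [integral_const_mul, h₂, mul_zero, Finset.sum_const_zero]
  have hvar : Var[f; P.map ξ] = ‖S.sqrtC₁ (∑ i ∈ F, b i • S.φ i)‖ ^ 2 := by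
    rw [← inner_C₁, ← covariance_self (by fun_prop)]
    have : (f : (ℕ → ℝ) → ℝ) = fun a => ∑ i ∈ F, b i * a i := funext hf
    rw [this, covariance_fun_sum_fun_sum' (fun i _ => (hmem i).const_mul _)
      (fun i _ => (hmem i).const_mul _)]
    simp only [covariance_const_mul_left, covariance_const_mul_right, h₃, map_sum, map_smul,
      sum_inner, inner_sum, real_inner_smul_left, real_inner_smul_right]
    rw [Finset.sum_comm]
  have hlaw := h₁.map_eq_gaussianReal f
  rw [hmean, hvar, Measure.map_map (by fun_prop) hξ] at hlaw
  have hcomp : (fun ω => ∑ i ∈ F, b i * ξ ω i) = f ∘ ξ := funext fun ω => (hf _).symm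
  rw [hcomp, hlaw, charFun_gaussianReal]
  congr 1
  rw [Real.coe_toNNReal _ (sq_nonneg _)]
  push_cast
  ring

section Joint

variable {L : X →L[ℝ] X} (hL : ∀ h, S.sqrtC₁ (L h) = S.Ainv (S.sqrtC₀ h))

include hL

/-- With `e = ∑ bᵢ φᵢ`, symmetry of `A⁻¹` collects the `u`-terms into `⟪u, x + A⁻¹ e⟫`, independent
of the noise term; `adjoint_sqrtC₁` rewrites its variance. -/
lemma charFun_joint (hn : 0 < n) (hu : Measurable u) (hξ : Measurable ξ)
    (hu_law : IsGaussianWith (P.map u) 0 (τ ^ 2 • S.C₀)) (hξ_law : S.IsNoiseLaw (P.map ξ))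
    (hind : IndepFun u ξ P) (x : X) (F : Finset ℕ) (b : ℕ → ℝ) :
    charFun (P.map fun ω => ⟪u ω, x⟫ + ∑ i ∈ F, b i * S.data n u ξ ω i) 1 =
      Complex.exp (-((τ ^ 2 * ‖S.sqrtC₀ x + adjoint L (∑ i ∈ F, b i • S.sqrtC₁ (S.φ i))‖ ^ 2 +
        n⁻¹ * ‖∑ i ∈ F, b i • S.sqrtC₁ (S.φ i)‖ ^ 2) / 2 : ℝ)) := by
  set e := ∑ i ∈ F, b i • S.φ i with he
  have he₁ : ∑ i ∈ F, b i • S.sqrtC₁ (S.φ i) = S.sqrtC₁ e := by simp [he]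
  have hsplit : (fun ω => ⟪u ω, x⟫ + ∑ i ∈ F, b i * S.data n u ξ ω i) =
      fun ω => ⟪u ω, x + S.Ainv e⟫ + ∑ i ∈ F, ((√n)⁻¹ * b i) * ξ ω i := by
    funext ω
    simp only [data, mul_add, Finset.sum_add_distrib, inner_add_right]
    rw [← inner_Ainv_left, he, inner_sum, add_assoc]
    congr 2
    · refine Finset.sum_congr rfl fun i _ => ?_
      rw [real_inner_smul_right, coeff, real_inner_comm]
    · refine Finset.sum_congr rfl fun i _ => ?_
      ring
  have hi : IndepFun (fun ω => ⟪u ω, x + S.Ainv e⟫) (fun ω => ∑ i ∈ F, ((√n)⁻¹ * b i) * ξ ω i) P :=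
    hind.comp (φ := fun z => ⟪z, x + S.Ainv e⟫)
      (ψ := fun a : ℕ → ℝ => ∑ i ∈ F, ((√n)⁻¹ * b i) * a i) (by fun_prop) (by fun_prop)
  have hsum : ∑ i ∈ F, ((√n)⁻¹ * b i) • S.φ i = (√n)⁻¹ • e := by
    simp only [he, Finset.smul_sum, smul_smul]
  rw [hsplit, hi.charFun_map_fun_add_eq_mul (by fun_prop) (by fun_prop), Pi.mul_apply,
    charFun_prior hu hu_law, charFun_noise hξ hξ_law, hsum, he₁, adjoint_sqrtC₁ hL, map_smul,
    norm_smul, mul_pow, map_add, ← Complex.exp_add]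
  rw [Real.norm_eq_abs, sq_abs, inv_pow, Real.sq_sqrt hn.le]
  congr 1
  push_cast
  ring

/-- The expected squared norm is finite: since `C₀^(1/2) A⁻¹ φₖ = L* C₁^(1/2) φₖ`, the signal
variances are dominated by those of the noise, and `summable_noise` controls both. -/
lemma Assumptions.ae_memScale (hS : S.Assumptions s₀ β ℓ c₁ c₂ c₃ c₄) (hn : 0 < n)
    (hu : Measurable u) (hξ : Measurable ξ)
    (hu_law : IsGaussianWith (P.map u) 0 (τ ^ 2 • S.C₀)) (hξ_law : S.IsNoiseLaw (P.map ξ))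
    (hind : IndepFun u ξ P) :
    ∀ᵐ y ∂(P.map (S.data n u ξ)), S.MemScale (2 * β - 2 * ℓ - 1) y := by
  have hd : Measurable (S.data n u ξ) := measurable_data hu hξ
  set a := 2 * β - 2 * ℓ - 1
  let v : ℕ → ℝ := fun k =>
    τ ^ 2 * ‖adjoint L (S.sqrtC₁ (S.φ k))‖ ^ 2 + n⁻¹ * ‖S.sqrtC₁ (S.φ k)‖ ^ 2
  have hv : ∀ k, 0 ≤ v k := fun k => by positivity
  have hlaw : ∀ k, P.map (fun ω => S.data n u ξ ω k) = gaussianReal 0 (v k).toNNReal := by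
    intro k
    have hdk : Measurable fun ω => S.data n u ξ ω k := (measurable_pi_apply k).comp hd
    have := Measure.isProbabilityMeasure_map (μ := P) hdk.aemeasurable
    refine Measure.ext_of_charFun (funext fun t => ?_)
    have h := charFun_joint hL hn hu hξ hu_law hξ_law hind 0 {k} (fun _ => t)
    simp only [inner_zero_right, Finset.sum_singleton, zero_add, map_zero, map_smul, norm_smul,
      mul_pow, Real.norm_eq_abs, sq_abs] at h
    rw [charFun_map_one (by fun_prop)] at h
    rw [charFun_gaussianReal, charFun_apply_real, integral_map hdk.aemeasurable (by fun_prop)]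
    rw [Real.coe_toNNReal _ (hv k)]
    calc _ = _ := integral_congr_ae (Eventually.of_forall fun ω => by push_cast; rfl)
      _ = _ := h
      _ = _ := by
        congr 1
        simp only [v]
        push_cast
        ring
  have hmom : ∀ k, ∫⁻ y, ENNReal.ofReal (S.κ k ^ (-a) * y k ^ 2) ∂(P.map (S.data n u ξ)) =
      ENNReal.ofReal (S.κ k ^ (-a) * v k) := by
    intro k
    have h1 : (P.map (S.data n u ξ)).map (fun y => y k) = gaussianReal 0 (v k).toNNReal := by
      rw [Measure.map_map (measurable_pi_apply k) hd, ← hlaw k]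
      rfl
    have h2 : ∫⁻ y, ENNReal.ofReal (S.κ k ^ (-a) * y k ^ 2) ∂(P.map (S.data n u ξ)) =
        ∫⁻ t, ENNReal.ofReal (S.κ k ^ (-a) * t ^ 2) ∂(gaussianReal 0 (v k).toNNReal) := by
      rw [← h1, lintegral_map (by fun_prop) (measurable_pi_apply k)]
    have h3 : MemLp id 2 (gaussianReal 0 (v k).toNNReal) := memLp_id_gaussianReal 2
    have h4 : ∫ t, t ^ 2 ∂(gaussianReal 0 (v k).toNNReal) = v k := by
      have := variance_eq_sub h3
      rw [variance_id_gaussianReal, Real.coe_toNNReal _ (hv k)] at this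
      simp only [id, integral_id_gaussianReal, Pi.pow_apply] at this
      linarith
    have h5 : Integrable (fun t : ℝ => t ^ 2) (gaussianReal 0 (v k).toNNReal) := h3.integrable_sq
    rw [h2, ← ofReal_integral_eq_lintegral_ofReal (h5.const_mul _)
      (Eventually.of_forall fun t =>
        mul_nonneg (Real.rpow_nonneg (S.κ_pos _).le _) (sq_nonneg _)), integral_const_mul, h4]
  have hsum : Summable fun k => S.κ k ^ (-a) * v k := by
    refine Summable.of_nonneg_of_le
      (fun k => mul_nonneg (Real.rpow_nonneg (S.κ_pos _).le _) (hv k)) (fun k => ?_)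
      (hS.summable_noise.mul_left (τ ^ 2 * ‖adjoint L‖ ^ 2 + n⁻¹))
    have h1 : ‖adjoint L (S.sqrtC₁ (S.φ k))‖ ^ 2 ≤ ‖adjoint L‖ ^ 2 * ‖S.sqrtC₁ (S.φ k)‖ ^ 2 := by
      rw [← mul_pow]
      gcongr
      exact (adjoint L).le_opNorm _
    have h2 : v k ≤ (τ ^ 2 * ‖adjoint L‖ ^ 2 + n⁻¹) * ‖S.sqrtC₁ (S.φ k)‖ ^ 2 := by
      have := mul_le_mul_of_nonneg_left h1 (sq_nonneg τ)
      simp only [v]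
      linarith
    calc _ ≤ _ := mul_le_mul_of_nonneg_left h2 (Real.rpow_nonneg (S.κ_pos k).le (-a))
      _ = _ := by ring
  have hfin : ∀ᵐ y ∂(P.map (S.data n u ξ)),
      ∑' k, ENNReal.ofReal (S.κ k ^ (-a) * y k ^ 2) < ⊤ := by
    refine ae_lt_top (by fun_prop) ?_
    rw [lintegral_tsum fun k => Measurable.aemeasurable (by fun_prop)]
    simp only [hmom]
    rw [← ENNReal.ofReal_tsum_of_nonneg
      (fun k => mul_nonneg (Real.rpow_nonneg (S.κ_pos _).le _) (hv k)) hsum]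
    exact ENNReal.ofReal_ne_top
  filter_upwards [hfin] with y hy
  refine (ENNReal.summable_toReal hy.ne).congr fun k => ?_
  rw [ENNReal.toReal_ofReal (mul_nonneg (Real.rpow_nonneg (S.κ_pos _).le _) (sq_nonneg _))]

end Joint

end Setting

end BayesInverse

/-! ### Independence from characteristic functions. -/

/-- A random vector and a random sequence are independent if their joint characteristic function is
a product. -/
lemma indepFun_of_charFun_map_one {X Ω : Type*} [NormedAddCommGroup X] [InnerProductSpace ℝ X]
    [CompleteSpace X] [SecondCountableTopology X] [MeasurableSpace X] [BorelSpace X]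
    [MeasurableSpace Ω] {P : Measure Ω} [IsProbabilityMeasure P] {Z : Ω → X} {y : Ω → ℕ → ℝ}
    (hZ : Measurable Z) (hy : Measurable y) {f : X → ℂ} {g : Finset ℕ → (ℕ → ℝ) → ℂ}
    (hf : f 0 = 1) (hg : ∀ F, g F 0 = 1)
    (h : ∀ v F b, charFun (P.map fun ω => ⟪Z ω, v⟫ + ∑ i ∈ F, b i * y ω i) 1 = f v * g F b) :
    IndepFun Z y P := by
  have hyi : ∀ i, Measurable fun ω => y ω i := fun i => (measurable_pi_apply i).comp hy
  refine IndepFun.indepFun_process (Y := fun i ω => y ω i) hZ hyi fun I => ?_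
  have hyI : Measurable fun ω => fun i : I => y ω i := measurable_pi_lambda _ fun i => hyi i
  refine (indepFun_iff_charFunDual_prod hZ.aemeasurable hyI.aemeasurable).2 fun Λ => ?_
  -- A functional on the product splits into a Riesz vector `v` and finitely many coefficients `b`.
  let v : X := (InnerProductSpace.toDual ℝ X).symm (Λ.comp (.inl ℝ X (I → ℝ)))
  let b : ℕ → ℝ := fun i => if hi : i ∈ I then Λ (0, Pi.single ⟨i, hi⟩ 1) else 0
  have hΛ₁ : ∀ x, Λ (x, 0) = ⟪x, v⟫ := fun x => by
    rw [real_inner_comm, InnerProductSpace.toDual_symm_apply]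
    rfl
  have hΛ₂ : ∀ a : ℕ → ℝ, Λ (0, fun i : I => a i) = ∑ i ∈ I, b i * a i := by
    intro a
    have h1 : (fun i : I => a i) = ∑ i : I, a i • Pi.single i (1 : ℝ) := by
      funext j
      simp [Finset.sum_apply, Pi.single_apply]
    have h2 := map_sum (Λ.comp (.inr ℝ X (I → ℝ))) (fun i : I => a i • Pi.single i (1 : ℝ))
      Finset.univ
    rw [← h1] at h2
    rw [← Finset.sum_coe_sort]
    refine h2.trans (Finset.sum_congr rfl fun i _ => ?_)
    rw [map_smul, smul_eq_mul, mul_comm]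
    simp [b]
  have hΛ : ∀ (x : X) (a : ℕ → ℝ), Λ (x, fun i : I => a i) = ⟪x, v⟫ + ∑ i ∈ I, b i * a i := by
    intro x a
    rw [← hΛ₁, ← hΛ₂, ← map_add]
    simp
  have e1 : charFunDual (P.map fun ω => (Z ω, fun i : I => y ω i)) Λ = f v * g I b := by
    rw [← h v I b, charFun_map_one (by fun_prop), charFunDual_apply,
      integral_map (by fun_prop) (by fun_prop)]
    simp only [hΛ]
  have e2 : charFunDual (P.map Z) (Λ.comp (.inl ℝ X (I → ℝ))) = f v := by
    have := h v I 0
    rw [hg, mul_one] at this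
    rw [← this, charFun_map_one (by fun_prop), charFunDual_apply,
      integral_map (by fun_prop) (by fun_prop)]
    simp [hΛ₁]
  have e3 : charFunDual (P.map fun ω => fun i : I => y ω i) (Λ.comp (.inr ℝ X (I → ℝ))) = g I b := by
    have := h 0 I b
    rw [hf, one_mul] at this
    rw [← this, charFun_map_one (by fun_prop), charFunDual_apply,
      integral_map (by fun_prop) (by fun_prop)]
    simp [hΛ₂]
  rw [e1, e2, e3]

/-! ### The law of the posterior error and its independence of the data. -/

namespace BayesInverse.Setting

variable {X : Type*} [NormedAddCommGroup X] [InnerProductSpace ℝ X] [CompleteSpace X]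
  [SecondCountableTopology X] [MeasurableSpace X] [BorelSpace X]
  {S : Setting X} {s₀ β ℓ c₁ c₂ c₃ c₄ : ℝ} {n τ : ℝ}
  {Ω : Type*} [MeasurableSpace Ω] {P : Measure Ω} [IsProbabilityMeasure P]
  {u : Ω → X} {ξ : Ω → ℕ → ℝ}

open ContinuousLinearMap (adjoint)

/-- Merges the test coefficients and the truncated series of `m(y)` into one finite combination, as
`charFun_joint` requires. -/
lemma sum_union_sub_smul {V : Type*} [AddCommGroup V] [Module ℝ V] (F G : Finset ℕ) (b d : ℕ → ℝ)
    (f : ℕ → V) :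
    ∑ i ∈ F ∪ G, ((if i ∈ F then b i else 0) - (if i ∈ G then d i else 0)) • f i =
      ∑ i ∈ F, b i • f i - ∑ i ∈ G, d i • f i := by
  simp only [sub_smul, ite_smul, zero_smul, Finset.sum_sub_distrib, Finset.sum_ite_mem]
  congr 2
  · rw [Finset.union_inter_cancel_left]
  · rw [Finset.union_inter_cancel_right]

section Posterior

variable {L : X →L[ℝ] X} (hL : ∀ h, S.sqrtC₁ (L h) = S.Ainv (S.sqrtC₀ h))
  {lam : ℝ} {R : X →L[ℝ] X} (hR : ∀ x, adjoint L (L (R x)) + lam • R x = x)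
  {m : (ℕ → ℝ) → X}

include hL hR

/-- The joint characteristic function of the posterior error `u - m(y)` and the data `y`. -/
lemma Assumptions.charFun_error_data (hS : S.Assumptions s₀ β ℓ c₁ c₂ c₃ c₄) (hn : 0 < n)
    (hτ : 0 < τ) (hlam : lam = 1 / (n * τ ^ 2))
    (hu : Measurable u) (hξ : Measurable ξ)
    (hu_law : IsGaussianWith (P.map u) 0 (τ ^ 2 • S.C₀)) (hξ_law : S.IsNoiseLaw (P.map ξ))
    (hind : IndepFun u ξ P) (hm : Measurable m)
    (hm_lim : ∀ᵐ ω ∂P, Tendsto (fun j => ∑ i ∈ Finset.range j,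
      S.data n u ξ ω i • S.sqrtC₀ (R (adjoint L (S.invSqrtC₁ (S.φ i))))) atTop
        (𝓝 (m (S.data n u ξ ω)))) (v : X) (F : Finset ℕ) (b : ℕ → ℝ) :
    charFun (P.map fun ω =>
        ⟪u ω - m (S.data n u ξ ω), v⟫ + ∑ i ∈ F, b i * S.data n u ξ ω i) 1 =
      Complex.exp (-(⟪(n⁻¹ • S.sqrtC₀.comp (R.comp S.sqrtC₀)) v, v⟫ / 2 : ℝ)) *
      Complex.exp (-((τ ^ 2 * ‖adjoint L (∑ i ∈ F, b i • S.sqrtC₁ (S.φ i))‖ ^ 2 +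
        n⁻¹ * ‖∑ i ∈ F, b i • S.sqrtC₁ (S.φ i)‖ ^ 2) / 2 : ℝ)) := by
  have hd : Measurable (S.data n u ξ) := measurable_data hu hξ
  have hdi : ∀ i, Measurable fun ω => S.data n u ξ ω i := fun i => (measurable_pi_apply i).comp hd
  have hmd : Measurable fun ω => m (S.data n u ξ ω) := hm.comp hd
  set h := R (S.sqrtC₀ v) with hh
  set b' := ∑ i ∈ F, b i • S.sqrtC₁ (S.φ i) with hb'
  let d : ℕ → ℝ := fun i => ⟪adjoint L (S.invSqrtC₁ (S.φ i)), h⟫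
  let cj : ℕ → ℕ → ℝ := fun j i =>
    (if i ∈ F then b i else 0) - (if i ∈ Finset.range j then d i else 0)
  let f : ℕ → Ω → ℝ := fun j ω =>
    ⟪u ω, v⟫ + ∑ i ∈ F ∪ Finset.range j, cj j i * S.data n u ξ ω i
  have hf : ∀ j, Measurable (f j) := fun j => by fun_prop
  have hlim : ∀ᵐ ω ∂P, Tendsto (fun j => f j ω) atTop
      (𝓝 (⟪u ω - m (S.data n u ξ ω), v⟫ + ∑ i ∈ F, b i * S.data n u ξ ω i)) := by
    filter_upwards [hm_lim] with ω hω
    have h1 := Filter.Tendsto.inner (𝕜 := ℝ) hω (tendsto_const_nhds (x := v))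
    have h2 := (tendsto_const_nhds (x := ⟪u ω, v⟫ + ∑ i ∈ F, b i * S.data n u ξ ω i)
      (f := (atTop : Filter ℕ))).sub h1
    rw [inner_sub_left, sub_add_eq_add_sub]
    refine h2.congr fun j => ?_
    have h3 := sum_union_sub_smul F (Finset.range j) b d (S.data n u ξ ω)
    simp only [smul_eq_mul] at h3
    simp only [f, cj, h3, sum_inner, real_inner_smul_left, add_sub_assoc]
    congr 2
    refine Finset.sum_congr rfl fun i _ => ?_
    rw [inner_sqrtC₀_left, resolvent_inner_left hR, mul_comm]
  have h1 := tendsto_charFun_map_one hf (by fun_prop) hlim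
  have h2 : ∀ j, charFun (P.map (f j)) 1 = _ := fun j =>
    charFun_joint hL hn hu hξ hu_law hξ_law hind v (F ∪ Finset.range j) (cj j)
  simp only [h2, cj, sum_union_sub_smul] at h1
  -- In the limit, subtracting `⟪m(y), v⟫` replaces `b'` by `b' - L h`.
  have h3 := (hS.hasSum_forward hL h).tendsto_sum_nat
  have h4 : Continuous fun z : X => Complex.exp (-((τ ^ 2 * ‖S.sqrtC₀ v + adjoint L (b' - z)‖ ^ 2 +
        n⁻¹ * ‖b' - z‖ ^ 2) / 2 : ℝ)) := by fun_prop
  refine (tendsto_nhds_unique h1 ((h4.tendsto _).comp h3)).trans ?_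
  rw [← Complex.exp_add]
  congr 1
  rw [← Complex.ofReal_neg, ← Complex.ofReal_neg, ← Complex.ofReal_neg, ← Complex.ofReal_add]
  congr 1
  have h5 : S.sqrtC₀ v + adjoint L (b' - L h) = lam • h + adjoint L b' := by
    rw [map_sub, hh]
    nth_rw 1 [← hR (S.sqrtC₀ v)]
    abel
  have h6 : ⟪(n⁻¹ • S.sqrtC₀.comp (R.comp S.sqrtC₀)) v, v⟫ =
      n⁻¹ * (‖L h‖ ^ 2 + lam * ‖h‖ ^ 2) := by
    rw [smul_apply, real_inner_smul_left, ContinuousLinearMap.comp_apply,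
      ContinuousLinearMap.comp_apply, inner_sqrtC₀_left, inner_resolvent_self hR]
  -- The cross terms `2 τ² lam ⟪h, L* b'⟫` and `-2 n⁻¹ ⟪b', L h⟫` cancel since `τ² lam = n⁻¹`; this
  -- is the independence.
  rw [h5, h6, norm_add_sq_real, norm_sub_sq_real, real_inner_smul_left,
    ContinuousLinearMap.adjoint_inner_right, norm_smul, real_inner_comm b', mul_pow,
    Real.norm_eq_abs, sq_abs, hlam]
  field_simp
  ring

/-- The posterior error `u - m(y)` is a centered Gaussian, and independent of the data. -/
lemma Assumptions.error_law (hS : S.Assumptions s₀ β ℓ c₁ c₂ c₃ c₄) (hn : 0 < n)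
    (hτ : 0 < τ) (hlam : lam = 1 / (n * τ ^ 2))
    (hu : Measurable u) (hξ : Measurable ξ)
    (hu_law : IsGaussianWith (P.map u) 0 (τ ^ 2 • S.C₀)) (hξ_law : S.IsNoiseLaw (P.map ξ))
    (hind : IndepFun u ξ P) (hm : Measurable m)
    (hm_lim : ∀ᵐ ω ∂P, Tendsto (fun j => ∑ i ∈ Finset.range j,
      S.data n u ξ ω i • S.sqrtC₀ (R (adjoint L (S.invSqrtC₁ (S.φ i))))) atTop
        (𝓝 (m (S.data n u ξ ω)))) :
    IsGaussianWith (P.map fun ω => u ω - m (S.data n u ξ ω)) 0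
        (n⁻¹ • S.sqrtC₀.comp (R.comp S.sqrtC₀)) ∧
      IndepFun (fun ω => u ω - m (S.data n u ξ ω)) (S.data n u ξ) P := by
  have hd : Measurable (S.data n u ξ) := measurable_data hu hξ
  have hZ : Measurable fun ω => u ω - m (S.data n u ξ ω) := hu.sub (hm.comp hd)
  have key := hS.charFun_error_data hL hR hn hτ hlam hu hξ hu_law hξ_law hind hm hm_lim
  have := Measure.isProbabilityMeasure_map (μ := P) hZ.aemeasurable
  constructor
  · refine isGaussianWith_zero_of_charFun
      (posDef_posterior hR hn (by rw [hlam]; positivity)) fun v => ?_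
    have h := key v ∅ 0
    rw [charFun_map_one (by fun_prop)] at h
    rw [charFun_apply, integral_map hZ.aemeasurable (by fun_prop)]
    simpa using h
  · exact indepFun_of_charFun_map_one hZ hd
      (f := fun v => Complex.exp (-(⟪(n⁻¹ • S.sqrtC₀.comp (R.comp S.sqrtC₀)) v, v⟫ / 2 : ℝ)))
      (g := fun F b => Complex.exp
        (-((τ ^ 2 * ‖adjoint L (∑ i ∈ F, b i • S.sqrtC₁ (S.φ i))‖ ^ 2 +
          n⁻¹ * ‖∑ i ∈ F, b i • S.sqrtC₁ (S.φ i)‖ ^ 2) / 2 : ℝ)))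
      (by simp) (by simp) key

end Posterior

end BayesInverse.Setting

/-! ### Assembly of the posterior. -/

theorem theorem2p1 {X : Type*} [NormedAddCommGroup X] [InnerProductSpace ℝ X] [CompleteSpace X]
    [TopologicalSpace.SeparableSpace X] [MeasurableSpace X] [BorelSpace X]
    (S : BayesInverse.Setting X)
    (s₀ β ℓ c₁ c₂ c₃ c₄ : ℝ) (hS : S.Assumptions s₀ β ℓ c₁ c₂ c₃ c₄)
    (n τ : ℝ) (hn : 0 < n) (hτ : 0 < τ)
    {Ω : Type*} [MeasurableSpace Ω] (P : Measure Ω) [IsProbabilityMeasure P]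
    (u : Ω → X) (ξ : Ω → ℕ → ℝ) (hu : Measurable u) (hξ : Measurable ξ)
    (hu_law : BayesInverse.IsGaussianWith (P.map u) 0 (τ ^ 2 • S.C₀))
    (hξ_law : S.IsNoiseLaw (P.map ξ)) (hind : IndepFun u ξ P) :
    (∀ w : X, S.MemScale 1 (S.coeff w) → S.Ainv w ∈ S.domInvSqrtC₁) ∧
    ∃ C : X →L[ℝ] X, BayesInverse.PositiveDefinite C ∧ S.HasPrecision n τ C ∧
      ∀ᵐ y ∂(P.map (S.data n u ξ)),
        ∃ r : ℕ → ℝ, (∀ r', S.IsAinvC₁inv (2 * β - 2 * ℓ - 1) y r' ↔ r' = r) ∧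
          ∃ m : X, (∀ m', S.IsWeakSolution (1 / (n * τ ^ 2)) r m' ↔ m' = m) ∧
            BayesInverse.IsGaussianWith (condDistrib u (S.data n u ξ) P y) m C := by
  have : SecondCountableTopology X := UniformSpace.secondCountable_of_separable X
  obtain ⟨L, hL⟩ := hS.exists_forward
  have hlam : 0 < 1 / (n * τ ^ 2) := by positivity
  obtain ⟨R, hR, hR'⟩ := BayesInverse.Setting.exists_resolvent L hlam
  refine ⟨fun w hw => hS.Ainv_mem hw, _, BayesInverse.Setting.posDef_posterior hR hn hlam,
    hS.hasPrecision hL hR hR' hn hτ rfl, ?_⟩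
  have hd : Measurable (S.data n u ξ) := BayesInverse.Setting.measurable_data hu hξ
  have hmem := hS.ae_memScale hL hn hu hξ hu_law hξ_law hind
  have hlim : ∀ y, S.MemScale (2 * β - 2 * ℓ - 1) y →
      Tendsto (fun j => ∑ i ∈ Finset.range j,
        y i • S.sqrtC₀ (R (ContinuousLinearMap.adjoint L (S.invSqrtC₁ (S.φ i))))) atTop
        (𝓝 (S.sqrtC₀ (R (∑' i, y i • ContinuousLinearMap.adjoint L (S.invSqrtC₁ (S.φ i)))))) := by
    intro y hy
    have h := (S.sqrtC₀.comp R).hasSum (hS.summable_data hL hy).hasSum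
    simpa only [map_smul, ContinuousLinearMap.comp_apply] using h.tendsto_sum_nat
  -- The series converges only for almost every `y`, so a measurable version of its limit is taken
  -- as `m`.
  obtain ⟨m, hm, hm_lim⟩ := measurable_limit_of_tendsto_metrizable_ae
    (μ := P.map (S.data n u ξ)) (L := atTop)
    (f := fun (j : ℕ) (y : ℕ → ℝ) => ∑ i ∈ Finset.range j,
      y i • S.sqrtC₀ (R (ContinuousLinearMap.adjoint L (S.invSqrtC₁ (S.φ i)))))
    (fun j => Measurable.aemeasurable (by fun_prop))
    (by filter_upwards [hmem] with y hy using ⟨_, hlim y hy⟩)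
  obtain ⟨hG, hI⟩ := hS.error_law hL hR hn hτ rfl hu hξ hu_law hξ_law hind hm
    (ae_of_ae_map hd.aemeasurable hm_lim)
  have hcond := condDistrib_ae_eq_map_add (m := m) hd hu (hu.sub (hm.comp hd)) hm
    (fun ω => (add_sub_cancel _ _).symm) hI
  filter_upwards [hmem, hm_lim, hcond] with y hy hmy hcy
  set q := ∑' i, y i • ContinuousLinearMap.adjoint L (S.invSqrtC₁ (S.φ i))
  -- Undoing `C₀^(1/2)` coefficientwise defines `r = C₀^(-1/2) q`.
  have hr : ∀ k, ⟪S.φ k, q⟫ = √(S.κ k) * (⟪S.φ k, q⟫ / √(S.κ k)) := fun k =>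
    (mul_div_cancel₀ _ (Real.sqrt_pos.2 (S.κ_pos k)).ne').symm
  refine ⟨_, hS.isAinvC₁inv_iff hL hy (hS.summable_data hL hy).hasSum hr, m y, fun m' => ?_, ?_⟩
  · rw [BayesInverse.Setting.isWeakSolution_iff hL hR hR' hr,
      tendsto_nhds_unique hmy (hlim y hy)]
  · rw [hcy]
    exact hG.map_const_add (m y)
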